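/- A polymatrix coordination game with individual preferences consists of an undirected graph $G=(N,E)$ on the players $N=\{1,\dots,n\}$, a finite non-empty strategy set $S_i$ and a non-negative function $q^i$ on $S_i$ for every player $i$, and a non-negative common payoff function $q^{ij}$ on $S_i\times S_j$ (with $q^{ij}(a,b)=q^{ji}(b,a)$) for every edge $\{i,j\}\in E$. The strategy sets may overlap. Player $i$ has payoff $p_i(s)=q^i(s_i)+\sum_{j:\{i,j\}\in E}q^{ij}(s_i,s_j)$, and the social welfare is $\mathrm{SW}(s)=\sum_{i\in N}p_i(s)$. The bimatrix game of every edge has positive entries on the diagonal only if $q^{ij}(a,b)>0$ implies $a=b$. For $K\subseteq N$ and a joint strategy $f_K$ of the players in $K$, let $\mathcal G[f_K]$ be the game of the players in $N\setminus K$ that arises when the players in $K$ are fixed to $f_K$; $f_K$ guarantees social welfare $z$ if $\mathrm{SW}(f_K,s_{-K})\ge z$ for every pure Nash equilibrium $s_{-K}$ of $\mathcal G[f_K]$. Theorem. There is a polynomial-time algorithm that, given a polymatrix coordination game with individual preferences $\mathcal G$ with (binary encoded) rational payoffs, in which the bimatrix game of every edge has positive entries on the diagonal only, and a number $k\in\{0,1,\dots,n\}$,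 computes a set $K\subseteq N$ of exactly $k$ players and a joint strategy $f_K$ of these players that guarantees social welfare $\frac{k}{2n}\,\mathrm{SW}(s^*)$, where $s^*$ is a joint strategy of maximum social welfare. (For $n=0$ the fraction is read as $0$.) The running time is polynomial in the size of the encoding of $(\mathcal G,k)$, which lists all strategies, individual preferences and edge payoff matrices explicitly. -/

import Mathlib

/-!
A machine model with a step count, polymatrix coordination games with individual preferences
(rational payoffs), strategy imposition, and the encoding of games and joint strategies.
-/

/-! ## Data and programs -/

/-- Finite binary trees: the data on which programs operate. -/
inductive Datum : Type
  | nil : Datum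
  | node : Datum → Datum → Datum

namespace Datum

/-- The number of vertices of the tree, i.e. the length of a serialization of it. -/
def size : Datum → ℕ
  | nil => 1
  | node a b => a.size + b.size + 1

/-- The left subtree (`nil` for `nil`). -/
def left : Datum → Datum
  | nil => nil
  | node a _ => a

/-- The right subtree (`nil` for `nil`). -/
def right : Datum → Datum
  | nil => nil
  | node _ b => b

/-- A list of trees, as a right comb. -/
def ofList : List Datum → Datum
  | [] => nil
  | a :: l => node a (ofList l)

/-- A bit. -/
def ofBool : Bool → Datum
  | false => nil
  | true => node nil nil

/-- A natural number in binary, least significant bit first. -/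
def ofNat (m : ℕ) : Datum := ofList (m.bits.map ofBool)

/-- A nonnegative rational number in lowest terms: numerator and denominator in binary. -/
def ofRat (r : ℚ) : Datum := node (ofNat r.num.natAbs) (ofNat r.den)

end Datum

/-- Programs of a WHILE language over binary trees. Every program transforms one tree into
another one. -/
inductive Prog : Type
  | id : Prog
  | nil : Prog
  | left : Prog
  | right : Prog
  | pair : Prog → Prog → Prog
  | seq : Prog → Prog → Prog
  | cond : Prog → Prog → Prog → Prog
  | loop : Prog → Prog → Prog

/-- `Runs c x y t`: on input `x` the program `c` halts with output `y` at cost `t`.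
The cost is not merely the number of executed instructions: each execution of a basic instruction
is charged with the size of the whole tree that it acts on, so that no step creates, copies,
inspects or discards data for free; a cost `t` run thus takes a multitape Turing machine a number
of steps that is polynomial in `t`, and conversely. -/
inductive Runs : Prog → Datum → Datum → ℕ → Prop
  | id (x : Datum) : Runs .id x x x.size
  | nil (x : Datum) : Runs .nil x .nil x.size
  | left (x : Datum) : Runs .left x x.left x.size
  | right (x : Datum) : Runs .right x x.right x.size
  /-- run both programs on `x` and combine the two results in a node -/
  | pair {f g : Prog} {x y z : Datum} {s t : ℕ} :
      Runs f x y s → Runs g x z t → Runs (.pair f g) x (.node y z) (s + t + 1)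
  /-- run `f`, then `g` on its result -/
  | seq {f g : Prog} {x y z : Datum} {s t : ℕ} :
      Runs f x y s → Runs g y z t → Runs (.seq f g) x z (s + t + 1)
  /-- if the test `c` yields `nil` on `x`, then run `g` on `x` -/
  | cond_nil {c f g : Prog} {x y : Datum} {s t : ℕ} :
      Runs c x .nil s → Runs g x y t → Runs (.cond c f g) x y (s + t + 1)
  /-- if the test `c` yields a node on `x`, then run `f` on `x` -/
  | cond_node {c f g : Prog} {x y a b : Datum} {s t : ℕ} :
      Runs c x (.node a b) s → Runs f x y t → Runs (.cond c f g) x y (s + t + 1)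
  /-- while-loop: if the test `c` yields `nil` on the current value, then stop with this value -/
  | loop_nil {c f : Prog} {x : Datum} {s : ℕ} :
      Runs c x .nil s → Runs (.loop c f) x x (s + 1)
  /-- while-loop: otherwise replace the current value by its image under the body and repeat -/
  | loop_node {c f : Prog} {x y z a b : Datum} {s t u : ℕ} :
      Runs c x (.node a b) s → Runs f x y t → Runs (.loop c f) y z u →
        Runs (.loop c f) x z (s + t + u + 1)

/-- The cost bounds the sizes of the input and of the output. -/
theorem Runs.size_le {c : Prog} {x y : Datum} {t : ℕ} (h : Runs c x y t) :
    x.size ≤ t ∧ y.size ≤ t := by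
  induction h with
  | id x => exact ⟨le_rfl, le_rfl⟩
  | nil x => cases x <;> simp [Datum.size]
  | left x => cases x <;> simp [Datum.size, Datum.left]; omega
  | right x => cases x <;> simp [Datum.size, Datum.right]; omega
  | pair _ _ ih1 ih2 => simp only [Datum.size]; omega
  | seq _ _ ih1 ih2 => omega
  | cond_nil _ _ ih1 ih2 => omega
  | cond_node _ _ ih1 ih2 => omega
  | loop_nil _ ih1 => omega
  | loop_node _ _ _ ih1 ih2 ih3 => omega

/-- Programs are deterministic: output and cost are determined by the input. -/
theorem Runs.unique {c : Prog} {x y : Datum} {t : ℕ} (h : Runs c x y t) :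
    ∀ {y' : Datum} {t' : ℕ}, Runs c x y' t' → y = y' ∧ t = t' := by
  induction h with
  | id | nil | left | right => intro y' t' h'; cases h'; exact ⟨rfl, rfl⟩
  | pair _ _ ih1 ih2 =>
    intro y' t' h'
    cases h' with
    | pair h1 h2 =>
      obtain ⟨rfl, rfl⟩ := ih1 h1; obtain ⟨rfl, rfl⟩ := ih2 h2; exact ⟨rfl, rfl⟩
  | seq _ _ ih1 ih2 =>
    intro y' t' h'
    cases h' with
    | seq h1 h2 =>
      obtain ⟨rfl, rfl⟩ := ih1 h1; obtain ⟨rfl, rfl⟩ := ih2 h2; exact ⟨rfl, rfl⟩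
  | cond_nil _ _ ih1 ih2 =>
    intro y' t' h'
    cases h' with
    | cond_nil h1 h2 =>
      obtain ⟨_, rfl⟩ := ih1 h1; obtain ⟨rfl, rfl⟩ := ih2 h2; exact ⟨rfl, rfl⟩
    | cond_node h1 h2 => cases (ih1 h1).1
  | cond_node _ _ ih1 ih2 =>
    intro y' t' h'
    cases h' with
    | cond_nil h1 h2 => cases (ih1 h1).1
    | cond_node h1 h2 =>
      obtain ⟨_, rfl⟩ := ih1 h1; obtain ⟨rfl, rfl⟩ := ih2 h2; exact ⟨rfl, rfl⟩
  | loop_nil _ ih1 =>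
    intro y' t' h'
    cases h' with
    | loop_nil h1 => obtain ⟨_, rfl⟩ := ih1 h1; exact ⟨rfl, rfl⟩
    | loop_node h1 h2 h3 => cases (ih1 h1).1
  | loop_node _ _ _ ih1 ih2 ih3 =>
    intro y' t' h'
    cases h' with
    | loop_nil h1 => cases (ih1 h1).1
    | loop_node h1 h2 h3 =>
      obtain ⟨_, rfl⟩ := ih1 h1; obtain ⟨rfl, rfl⟩ := ih2 h2; obtain ⟨rfl, rfl⟩ := ih3 h3
      exact ⟨rfl, rfl⟩

/-! ## Polymatrix coordination games with individual preferences -/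

/-- A polymatrix coordination game with individual preferences on the players `Fin n`, with
rational payoffs. Strategies are named by natural numbers, and different players may have
strategies in common. Only the values of `pref i` on `S i`, and those of `edgePay i j` on
`S i × S j` for edges `{i, j}`, play a role. -/
structure CoordGame (n : ℕ) where
  /-- the graph of the game -/
  graph : SimpleGraph (Fin n)
  /-- the strategy sets -/
  S : Fin n → Finset ℕ
  S_nonempty : ∀ i, (S i).Nonempty
  /-- the individual preference `q^i` -/
  pref : Fin n → ℕ → ℚ
  pref_nonneg : ∀ i, ∀ a ∈ S i, 0 ≤ pref i a
  /-- the common payoff `q^{ij}` of both endpoints of the edge `{i, j}` -/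
  edgePay : Fin n → Fin n → ℕ → ℕ → ℚ
  edgePay_nonneg : ∀ i j, graph.Adj i j → ∀ a ∈ S i, ∀ b ∈ S j, 0 ≤ edgePay i j a b
  edgePay_symm : ∀ i j, graph.Adj i j → ∀ a ∈ S i, ∀ b ∈ S j, edgePay i j a b = edgePay j i b a

namespace CoordGame

variable {n : ℕ}

/-- Joint strategies of all players. -/
abbrev Profile (G : CoordGame n) : Type := ∀ i : Fin n, {a : ℕ // a ∈ G.S i}

/-- Joint strategies `f_K` of the players in `K`. -/
abbrev PartialProfile (G : CoordGame n) (K : Finset (Fin n)) : Type :=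
  ∀ i : {i : Fin n // i ∈ K}, {a : ℕ // a ∈ G.S i.1}

/-- Joint strategies `s_{-K}` of the players outside `K`. -/
abbrev CoProfile (G : CoordGame n) (K : Finset (Fin n)) : Type :=
  ∀ i : {i : Fin n // i ∉ K}, {a : ℕ // a ∈ G.S i.1}

open Classical in
/-- The payoff `p_i(s) = q^i(s_i) + ∑_{j ∈ N_i} q^{ij}(s_i, s_j)`. -/
noncomputable def payoff (G : CoordGame n) (s : G.Profile) (i : Fin n) : ℚ :=
  G.pref i (s i) + ∑ j with G.graph.Adj i j, G.edgePay i j (s i) (s j)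

/-- The social welfare. -/
noncomputable def welfare (G : CoordGame n) (s : G.Profile) : ℚ := ∑ i, G.payoff s i

/-- A social optimum: a joint strategy of maximum social welfare. -/
def IsSocialOptimum (G : CoordGame n) (s : G.Profile) : Prop :=
  ∀ s' : G.Profile, G.welfare s' ≤ G.welfare s

/-- The bimatrix game of every edge has positive entries on the diagonal only. -/
def DiagonalOnly (G : CoordGame n) : Prop :=
  ∀ i j, G.graph.Adj i j → ∀ a ∈ G.S i, ∀ b ∈ G.S j, 0 < G.edgePay i j a b → a = b

/-- The joint strategy `(f_K, s_{-K})`. -/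
def combine (G : CoordGame n) (K : Finset (Fin n)) (f : G.PartialProfile K) (r : G.CoProfile K) :
    G.Profile :=
  fun i => if h : i ∈ K then f ⟨i, h⟩ else r ⟨i, h⟩

/-- `s_{-K}` is a (pure) Nash equilibrium of the game `G[f_K]` that is played by the players
outside `K` once the strategies of the players in `K` are fixed according to `f_K`. -/
def IsNashGiven (G : CoordGame n) (K : Finset (Fin n)) (f : G.PartialProfile K)
    (r : G.CoProfile K) : Prop :=
  ∀ (i : {i : Fin n // i ∉ K}) (a : {a : ℕ // a ∈ G.S i.1}),
    ¬ G.payoff (G.combine K f r) i.1 < G.payoff (G.combine K f (Function.update r i a)) i.1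

/-- `f_K` guarantees social welfare `z`. -/
def Guarantees (G : CoordGame n) (K : Finset (Fin n)) (f : G.PartialProfile K) (z : ℚ) : Prop :=
  ∀ r : G.CoProfile K, G.IsNashGiven K f r → z ≤ G.welfare (G.combine K f r)

/-! ## Encodings -/

/-- Player `i`: the list of the strategies with their individual preference values. -/
def encodePlayer (G : CoordGame n) (i : Fin n) : Datum :=
  Datum.ofList (((G.S i).sort (· ≤ ·)).map fun a => .node (.ofNat a) (.ofRat (G.pref i a)))

open Classical in
/-- The pair `(i, j)`: `nil` if it is not an edge, and otherwise a flag followed by the payoff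
matrix, row by row. -/
noncomputable def encodePair (G : CoordGame n) (i j : Fin n) : Datum :=
  if G.graph.Adj i j then
    .node .nil (Datum.ofList (((G.S i).sort (· ≤ ·)).map fun a =>
      Datum.ofList (((G.S j).sort (· ≤ ·)).map fun b => .ofRat (G.edgePay i j a b))))
  else .nil

/-- The whole game: the list of the players and the matrix of all pairs of players. -/
noncomputable def encode (G : CoordGame n) : Datum :=
  .node (Datum.ofList (List.ofFn fun i => G.encodePlayer i))
    (Datum.ofList (List.ofFn fun i => Datum.ofList (List.ofFn fun j => G.encodePair i j)))

/-- A joint strategy of the players in `K`: the list that contains, for every player, `nil` if the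
player is not in `K`, and otherwise a flag followed by the strategy of the player. -/
def encodePartial (G : CoordGame n) (K : Finset (Fin n)) (f : G.PartialProfile K) : Datum :=
  Datum.ofList (List.ofFn fun i =>
    if h : i ∈ K then .node .nil (.ofNat (f ⟨i, h⟩)) else .nil)

end CoordGame

/-!
For `k` players to guarantee `k / (2 * n)` of the optimum, it suffices to impose on them their
strategies in a joint strategy `s` whose welfare is at least half of the optimum, where the players
with the largest payoffs in `s` are selected. In an equilibrium every other player does at least as
well as by returning to `s`. So the welfare is at least what all players would receive in `s` from
the selected ones, and by symmetry this is what the selected players would receive in `s`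
(`CoordGame.sum_payoff_le_welfare`). The `k` largest of `n` payoffs make up at least `k / n` of their
sum (`mul_sum_le_mul_sum_rankBelow`).

It remains to compute such an `s`. As payoffs are positive on the diagonal only, strategies are
colours of the players, the welfare of a colouring is the sum of the weights `W i j c` over all
ordered pairs `i, j` of the same colour `c`, and individual preferences are the weights of the pairs
`i, i`. The linear program that relaxes this problem maximizes `∑ W i j c * min (x i c) (x j c)` over
fractional colourings `x`, and the randomized rounding of Kleinberg and Tardos (repeatedly draw a
colour `c` and a threshold, and give colour `c` to those uncoloured players for which `x i c` exceeds
the threshold) keeps at least half of its value. Neither an exact solution of the linear program nor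
arithmetic with large numbers is needed, because the rounding gains more than half: a pair `i, j`
keeps a fraction `1 / (2 - m)`, where `m` is the sum of `min (x i c) (x j c)` over all `c`. As `m` is
at least the payoff of the pair divided by the largest weight, and there are only `n ^ 2` pairs, the
gain outweighs an error of order `n ^ 2` when the largest weight is scaled to `16 * n ^ 4`
(`le_two_mul_sum_colourPayoff`). Hence

* the weights may be rounded to integers of polynomial size (`rounded`), which are represented in
  unary; only this step compares rational numbers in binary;
* the linear program may be solved approximately, by a play in which in every round each player
  chooses a colour of maximum marginal value in the current fractional colouring. With a smooth
  substitute for the minimum this is a gradient ascent (`potential_counts_succ`), and after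
  polynomially many rounds the value is within `n ^ 2` of the optimum (`welfare_le_overlap`).

The rounding is derandomized with conditional expectations: on average over all colours and
thresholds the estimate of the final welfare does not decrease (`sum_pairEstimate_sub_nonneg`).

For the running time, `PolyTime e g` expresses that some program computes `g y` from `e y` in
polynomial time, uniformly in `y`. This notion is closed under composition, bounded recursion with
states of polynomial size, bounded sums and tabulation, and the algorithm is written as a function
that is assembled from these (`PolyTime.imposition`).
-/

/-! ### Computability in polynomial time -/

/-- `g y` can be computed from `e y`, by one program and in time polynomial in the size of `e y`.
The index `y` ranges over an arbitrary type, so that `e` plays the role of an environment in which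
the values of the variables are stored. -/
def PolyTime {Y : Type} (e g : Y → Datum) : Prop :=
  ∃ (c : Prog) (p : Polynomial ℕ), ∀ y, ∃ t, t ≤ p.eval (e y).size ∧ Runs c (e y) (g y) t

theorem Polynomial.eval_mono_nat (p : Polynomial ℕ) {a b : ℕ} (h : a ≤ b) :
    p.eval a ≤ p.eval b := by
  simp only [Polynomial.eval_eq_sum_range]
  gcongr

namespace Datum

theorem size_pos (d : Datum) : 0 < d.size := by cases d <;> simp [size]

/-- A natural number in unary. -/
def unary : ℕ → Datum
  | 0 => nil
  | m + 1 => node nil (unary m)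

/-- The length of the right spine: the length of a list, or the value of a unary number. -/
def len : Datum → ℕ
  | nil => 0
  | node _ b => b.len + 1

/-- The entry with index `i` of a list (`nil` if there is none). -/
def nth (d : Datum) (i : ℕ) : Datum := (right^[i] d).left

/-- The list of the values of `f` at `0, …, m - 1`. -/
def table (m : ℕ) (f : ℕ → Datum) : Datum := ofList ((List.range m).map f)

/-- Case distinction on whether `t` is a leaf. -/
def ifNode (t a b : Datum) : Datum :=
  match t with
  | nil => b
  | node _ _ => a

@[simp] theorem size_unary (m : ℕ) : (unary m).size = 2 * m + 1 := by
  induction m with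
  | zero => rfl
  | succ m ih => simp [unary, size, ih]; omega

@[simp] theorem len_unary (m : ℕ) : (unary m).len = m := by
  induction m with
  | zero => rfl
  | succ m ih => simp [unary, len, ih]

theorem len_le_size (d : Datum) : d.len ≤ d.size := by
  induction d with
  | nil => simp [len]
  | node a b _ ih => simp [len, size]; omega

theorem size_right_le (d : Datum) : d.right.size ≤ d.size := by
  cases d <;> simp [right, size]; omega

theorem size_iterate_right_le (d : Datum) (i : ℕ) : (right^[i] d).size ≤ d.size := by
  induction i with
  | zero => rfl
  | succ i ih => rw [Function.iterate_succ_apply']; exact (size_right_le _).trans ih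

theorem len_right (d : Datum) : d.right.len = d.len - 1 := by
  cases d <;> simp [right, len]

theorem len_iterate_right (d : Datum) (i : ℕ) : (right^[i] d).len = d.len - i := by
  induction i with
  | zero => rfl
  | succ i ih => rw [Function.iterate_succ_apply', len_right, ih]; omega

theorem len_ofList (l : List Datum) : (ofList l).len = l.length := by
  induction l with
  | nil => rfl
  | cons a l ih => simp [ofList, len, ih]

theorem nth_nil (i : ℕ) : nth nil i = nil := by
  have : right^[i] nil = nil := by
    induction i with
    | zero => rfl
    | succ i ih => rw [Function.iterate_succ_apply', ih]; rfl
  simp [nth, this, left]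

theorem nth_ofList (l : List Datum) (i : ℕ) : nth (ofList l) i = l.getD i nil := by
  induction l generalizing i with
  | nil => simp [ofList, nth_nil]
  | cons a l ih =>
    cases i with
    | zero => simp [nth, ofList, left]
    | succ i => simpa [nth, ofList, right] using ih i

theorem nth_table {m i : ℕ} (f : ℕ → Datum) (h : i < m) : nth (table m f) i = f i := by
  simp [table, nth_ofList, List.getD, h]

theorem size_ofList (l : List Datum) : (ofList l).size = (l.map fun d => d.size + 1).sum + 1 := by
  induction l with
  | nil => rfl
  | cons a l ih => simp [ofList, size, ih]; omega

end Datum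

open Datum

namespace PolyTime

variable {Y Z : Type} {e g h : Y → Datum}

theorem comp (hg : PolyTime e g) (hh : PolyTime g h) : PolyTime e h := by
  obtain ⟨c, p, hc⟩ := hg
  obtain ⟨c', p', hc'⟩ := hh
  refine ⟨.seq c c', p + p'.comp p + 1, fun y => ?_⟩
  obtain ⟨t, ht, r⟩ := hc y
  obtain ⟨t', ht', r'⟩ := hc' y
  refine ⟨_, ?_, .seq r r'⟩
  have := p'.eval_mono_nat (r.size_le.2.trans ht)
  simp only [Polynomial.eval_add, Polynomial.eval_comp, Polynomial.eval_one]
  omega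

theorem reindex (φ : Z → Y) (hg : PolyTime e g) :
    PolyTime (fun z => e (φ z)) (fun z => g (φ z)) := by
  obtain ⟨c, p, hc⟩ := hg
  exact ⟨c, p, fun z => hc (φ z)⟩

theorem refl (e : Y → Datum) : PolyTime e e :=
  ⟨.id, .X, fun y => ⟨_, by simp, .id _⟩⟩

theorem nil (e : Y → Datum) : PolyTime e fun _ => .nil :=
  ⟨.nil, .X, fun y => ⟨_, by simp, .nil _⟩⟩

theorem left (hg : PolyTime e g) : PolyTime e fun y => (g y).left :=
  hg.comp ⟨.left, .X, fun y => ⟨_, by simp, .left _⟩⟩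

theorem right (hg : PolyTime e g) : PolyTime e fun y => (g y).right :=
  hg.comp ⟨.right, .X, fun y => ⟨_, by simp, .right _⟩⟩

theorem node (hg : PolyTime e g) (hh : PolyTime e h) : PolyTime e fun y => .node (g y) (h y) := by
  obtain ⟨c, p, hc⟩ := hg
  obtain ⟨c', p', hc'⟩ := hh
  refine ⟨.pair c c', p + p' + 1, fun y => ?_⟩
  obtain ⟨t, ht, r⟩ := hc y
  obtain ⟨t', ht', r'⟩ := hc' y
  refine ⟨_, ?_, .pair r r'⟩
  simp only [Polynomial.eval_add, Polynomial.eval_one]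
  omega

theorem ifNode {t : Y → Datum} (ht : PolyTime e t) (hg : PolyTime e g) (hh : PolyTime e h) :
    PolyTime e fun y => (t y).ifNode (g y) (h y) := by
  obtain ⟨c, p, hc⟩ := hg
  obtain ⟨c', p', hc'⟩ := hh
  obtain ⟨c₀, p₀, hc₀⟩ := ht
  refine ⟨.cond c₀ c c', p + p' + p₀ + 1, fun y => ?_⟩
  obtain ⟨k, hk, r⟩ := hc y
  obtain ⟨k', hk', r'⟩ := hc' y
  obtain ⟨k₀, hk₀, r₀⟩ := hc₀ y
  simp only [Polynomial.eval_add, Polynomial.eval_one]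
  revert r₀
  cases t y with
  | nil => exact fun r₀ => ⟨_, by omega, .cond_nil r₀ r'⟩
  | node a b => exact fun r₀ => ⟨_, by omega, .cond_node r₀ r⟩

theorem const (e : Y → Datum) (d : Datum) : PolyTime e fun _ => d := by
  induction d with
  | nil => exact .nil e
  | node a b iha ihb => exact iha.node ihb

/-- The output of a polynomial-time program has polynomial size. -/
theorem exists_size_le (hg : PolyTime e g) :
    ∃ p : Polynomial ℕ, ∀ y, (g y).size ≤ p.eval (e y).size := by
  obtain ⟨c, p, hc⟩ := hg
  refine ⟨p, fun y => ?_⟩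
  obtain ⟨t, ht, r⟩ := hc y
  exact r.size_le.2.trans ht

end PolyTime

/-- `f y`, in unary, can be computed from `e y` in polynomial time. -/
abbrev PolyTimeNat {Y : Type} (e : Y → Datum) (f : Y → ℕ) : Prop :=
  PolyTime e fun y => unary (f y)

/-- The environment `e` extended by a natural number. -/
def withNat {Y : Type} (e : Y → Datum) (z : Y × ℕ) : Datum := .node (e z.1) (unary z.2)

/-- The environment `e` extended by a tree. -/
def withDatum {Y : Type} (e : Y → Datum) (z : Y × Datum) : Datum := .node (e z.1) z.2

section Recursion

variable {Y : Type} {e g : Y → Datum}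

namespace PolyTime

theorem lift (hg : PolyTime e g) : PolyTime (withNat e) fun z => g z.1 :=
  (refl (withNat e)).left.comp (hg.reindex Prod.fst)

theorem liftD (hg : PolyTime e g) : PolyTime (withDatum e) fun z => g z.1 :=
  (refl (withDatum e)).left.comp (hg.reindex Prod.fst)

theorem lastD (e : Y → Datum) : PolyTime (withDatum e) fun z => z.2 :=
  (refl (withDatum e)).right

/-- A loop that is executed once for every entry of the list `r y`. The state `S y i` after `i`
rounds has to be computable from the previous one, and its size must remain polynomial. -/
theorem iterate {r : Y → Datum} {S : Y → ℕ → Datum} (hr : PolyTime e r)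
    (h0 : PolyTime e fun y => S y 0)
    (hS : PolyTime (fun z : Y × ℕ => .node (withNat e z) (S z.1 z.2)) fun z => S z.1 (z.2 + 1))
    (hB : ∃ q : Polynomial ℕ, ∀ y, ∀ i ≤ (r y).len, (S y i).size ≤ q.eval (e y).size) :
    PolyTime e fun y => S y (r y).len := by
  let st : Y × ℕ → Datum := fun z =>
    .node (withNat e z) (.node (Datum.right^[z.2] (r z.1)) (S z.1 z.2))
  have htest : PolyTime st fun z => Datum.right^[z.2] (r z.1) := (refl st).right.left
  have hbody : PolyTime st fun z => st (z.1, z.2 + 1) := by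
    have h1 : PolyTime st fun z => e z.1 := (refl st).left.left
    have h2 : PolyTime st fun z => unary (z.2 + 1) := (nil st).node (refl st).left.right
    have h3 : PolyTime st fun z => Datum.right^[z.2 + 1] (r z.1) := by
      simp only [Function.iterate_succ_apply']
      exact htest.right
    have h4 : PolyTime st fun z => .node (withNat e z) (S z.1 z.2) :=
      (refl st).left.node (refl st).right.right
    exact (h1.node h2).node (h3.node (h4.comp hS))
  have hinit : PolyTime e fun y => st (y, 0) :=
    ((refl e).node (nil e)).node (hr.node h0)
  obtain ⟨cT, pT, hT⟩ := htest
  obtain ⟨cB, pB, hbd⟩ := hbody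
  obtain ⟨q, hq⟩ := hB
  obtain ⟨qr, hqr⟩ := hr.exists_size_le
  let Q : Polynomial ℕ := .X + 3 * qr + q + 4
  have hQ : ∀ y, ∀ i ≤ (r y).len, (st (y, i)).size ≤ Q.eval (e y).size := by
    intro y i hi
    have h1 := hq y i hi
    have h3 := hqr y
    have h4 := size_iterate_right_le (r y) i
    have h5 := len_le_size (r y)
    simp only [st, withNat, size, size_unary, Q, Polynomial.eval_add, Polynomial.eval_mul,
      Polynomial.eval_X, Polynomial.eval_ofNat]
    omega
  have hloop : PolyTime (fun y => st (y, 0)) fun y => st (y, (r y).len) := by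
    refine ⟨.loop cT cB, (.X + 1) * (pT.comp (Q) + pB.comp Q + 1), fun y => ?_⟩
    have key : ∀ j i, i + j = (r y).len → ∃ t,
        t ≤ (j + 1) * (pT.eval (Q.eval (e y).size) + pB.eval (Q.eval (e y).size) + 1) ∧
        Runs (.loop cT cB) (st (y, i)) (st (y, (r y).len)) t := by
      intro j
      induction j with
      | zero =>
        rintro i rfl
        obtain ⟨t, ht, hrun⟩ := hT (y, (r y).len)
        have hnil : Datum.right^[(r y).len] (r y) = .nil := by
          have := len_iterate_right (r y) (r y).len
          revert this
          cases Datum.right^[(r y).len] (r y) <;> simp [len]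
        simp only [hnil] at hrun
        have := pT.eval_mono_nat (hQ y _ le_rfl)
        exact ⟨_, by omega, .loop_nil hrun⟩
      | succ j ih =>
        intro i hi
        obtain ⟨t, ht, hrun⟩ := hT (y, i)
        obtain ⟨t', ht', hrun'⟩ := hbd (y, i)
        obtain ⟨u, hu, hrec⟩ := ih (i + 1) (by omega)
        obtain ⟨a, b, hab⟩ : ∃ a b, Datum.right^[i] (r y) = .node a b := by
          have := len_iterate_right (r y) i
          revert this
          cases Datum.right^[i] (r y) with
          | nil => simp only [len]; omega
          | node a b => exact fun _ => ⟨a, b, rfl⟩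
        simp only [hab] at hrun
        have h1 := pT.eval_mono_nat (hQ y i (by omega))
        have h2 := pB.eval_mono_nat (hQ y i (by omega))
        refine ⟨_, ?_, .loop_node hrun hrun' hrec⟩
        rw [add_mul (j + 1) 1]
        omega
    obtain ⟨t, ht, hrun⟩ := key (r y).len 0 (by omega)
    refine ⟨t, ht.trans ?_, hrun⟩
    have h1 : (e y).size ≤ (st (y, 0)).size := by simp [st, withNat, size]; omega
    have h2 : (r y).len ≤ (st (y, 0)).size := by
      have := len_le_size (r y)
      simp [st, size]; omega
    simp only [Polynomial.eval_add, Polynomial.eval_mul, Polynomial.eval_X, Polynomial.eval_one,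
      Polynomial.eval_comp]
    have hQm := Q.eval_mono_nat h1
    gcongr
    · exact pT.eval_mono_nat hQm
    · exact pB.eval_mono_nat hQm
  exact hinit.comp (hloop.comp (refl (fun y => st (y, (r y).len))).right.right)

end PolyTime

namespace PolyTimeNat

variable {f f' : Y → ℕ}

theorem lift (hf : PolyTimeNat e f) : PolyTimeNat (withNat e) fun z => f z.1 :=
  PolyTime.lift hf

theorem liftD (hf : PolyTimeNat e f) : PolyTimeNat (withDatum e) fun z => f z.1 :=
  PolyTime.liftD hf

theorem last (e : Y → Datum) : PolyTimeNat (withNat e) fun z => z.2 :=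
  (PolyTime.refl (withNat e)).right

theorem const (e : Y → Datum) (m : ℕ) : PolyTimeNat e fun _ => m := PolyTime.const e _

theorem add (hf : PolyTimeNat e f) (hf' : PolyTimeNat e f') :
    PolyTimeNat e fun y => f y + f' y := by
  have := PolyTime.iterate (r := fun y => unary (f' y)) (S := fun y i => unary (f y + i))
    hf' hf ((PolyTime.nil _).node (PolyTime.refl _).right)
    ((hf.node hf').exists_size_le.imp fun q hq y i hi => (hq y).trans' (by
      simp [size] at hi ⊢
      omega))
  simpa using this

theorem len {d : Y → Datum} (hd : PolyTime e d) : PolyTimeNat e fun y => (d y).len :=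
  PolyTime.iterate (S := fun _ i => unary i)
    hd (PolyTime.nil e) ((PolyTime.nil _).node (PolyTime.refl _).right)
    ((hd.node hd).exists_size_le.imp fun q hq y i hi => (hq y).trans' (by
      have := len_le_size (d y)
      simp [size]
      omega))

end PolyTimeNat

theorem PolyTime.iterate_right {d : Y → Datum} {f : Y → ℕ} (hd : PolyTime e d)
    (hf : PolyTimeNat e f) : PolyTime e fun y => Datum.right^[f y] (d y) := by
  have := PolyTime.iterate (r := fun y => unary (f y)) (S := fun y i => Datum.right^[i] (d y))
    hf hd (by
      simp only [Function.iterate_succ_apply']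
      exact (PolyTime.refl _).right.right)
    (hd.exists_size_le.imp fun q hq y i _ => (size_iterate_right_le _ _).trans (hq y))
  simpa using this

theorem PolyTime.nth {d : Y → Datum} {f : Y → ℕ} (hd : PolyTime e d)
    (hf : PolyTimeNat e f) : PolyTime e fun y => (d y).nth (f y) :=
  (hd.iterate_right hf).left

/-- Recursion, where the step function is given on arbitrary trees. -/
theorem PolyTime.natRec {b : Y → ℕ} {init : Y → Datum} {F : Y → ℕ → Datum → Datum}
    {S : Y → ℕ → Datum} (hb : PolyTimeNat e b) (h0 : PolyTime e init)
    (hF : PolyTime (withDatum (withNat e)) fun z => F z.1.1 z.1.2 z.2)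
    (hS0 : ∀ y, S y 0 = init y) (hS : ∀ y i, S y (i + 1) = F y i (S y i))
    (hB : ∃ q : Polynomial ℕ, ∀ y, ∀ i ≤ b y, (S y i).size ≤ q.eval (e y).size) :
    PolyTime e fun y => S y (b y) := by
  have := PolyTime.iterate (r := fun y => unary (b y)) (S := S) hb
    (by simpa only [hS0] using h0)
    (by
      simp only [hS]
      exact hF.reindex fun z : Y × ℕ => ((z, S z.1 z.2) : (Y × ℕ) × Datum)) (by simpa using hB)
  simpa using this

namespace PolyTimeNat

variable {f f' : Y → ℕ}

theorem exists_le (hf : PolyTimeNat e f) : ∃ p : Polynomial ℕ, ∀ y, f y ≤ p.eval (e y).size := by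
  obtain ⟨p, hp⟩ := PolyTime.exists_size_le hf
  refine ⟨p, fun y => ?_⟩
  have := hp y
  rw [size_unary] at this
  omega

theorem sub (hf : PolyTimeNat e f) (hf' : PolyTimeNat e f') :
    PolyTimeNat e fun y => f y - f' y := by
  have h : ∀ m i, Datum.right^[i] (unary m) = unary (m - i) := by
    intro m i
    induction i with
    | zero => rfl
    | succ i ih =>
      rw [Function.iterate_succ_apply', ih, Nat.sub_succ]
      cases m - i <;> rfl
  simpa only [h] using PolyTime.iterate_right hf hf'

end PolyTimeNat

/-- The values of a function that is computable in polynomial time are bounded by one polynomial,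
uniformly for all arguments below a bound. -/
theorem PolyTime.exists_size_le_of_lt {b : Y → ℕ} {F : Y → ℕ → Datum} (hb : PolyTimeNat e b)
    (hF : PolyTime (withNat e) fun z => F z.1 z.2) :
    ∃ q : Polynomial ℕ, ∀ y, ∀ i < b y, (F y i).size ≤ q.eval (e y).size := by
  obtain ⟨pF, hpF⟩ := hF.exists_size_le
  obtain ⟨pb, hpb⟩ := hb.exists_le
  refine ⟨pF.comp (.X + 2 * pb + 2), fun y i hi => (hpF (y, i)).trans ?_⟩
  rw [Polynomial.eval_comp]
  refine pF.eval_mono_nat ?_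
  have := hpb y
  simp [withNat, size]
  omega

/-- Tabulation. -/
theorem PolyTime.table {b : Y → ℕ} {F : Y → ℕ → Datum} (hb : PolyTimeNat e b)
    (hF : PolyTime (withNat e) fun z => F z.1 z.2) :
    PolyTime e fun y => Datum.table (b y) (F y) := by
  -- The list is built from its end: after `i` rounds, it holds the last `i` of the values.
  let S : Y → ℕ → Datum := fun y i =>
    Nat.rec .nil (fun l d => .node (F y (b y - 1 - l)) d) i
  have hS : ∀ y, ∀ i ≤ b y, S y i = Datum.ofList ((List.range' (b y - i) i).map (F y)) := by
    intro y i
    induction i with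
    | zero => intro _; rfl
    | succ i ih =>
      intro hi
      have h1 : b y - 1 - i = b y - (i + 1) := by omega
      have h2 : b y - i = b y - (i + 1) + 1 := by omega
      change Datum.node (F y (b y - 1 - i)) (S y i) = _
      rw [ih (by omega), List.range'_succ, List.map_cons, Datum.ofList, h1, h2]
  have hF' : PolyTime (withDatum (withNat e)) fun z : (Y × ℕ) × Datum =>
      .node (F z.1.1 (b z.1.1 - 1 - z.1.2)) z.2 := by
    have h1 : PolyTimeNat (withNat e) fun z => b z.1 - 1 - z.2 :=
      (hb.lift.sub (.const _ 1)).sub (.last e)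
    have h2 : PolyTime (withNat e) fun z => F z.1 (b z.1 - 1 - z.2) :=
      PolyTime.comp (g := fun z : Y × ℕ => withNat e (z.1, b z.1 - 1 - z.2))
        ((PolyTime.refl e).lift.node h1)
        (hF.reindex fun z : Y × ℕ => (z.1, b z.1 - 1 - z.2))
    exact h2.liftD.node (.lastD _)
  obtain ⟨p, hp⟩ := PolyTime.exists_size_le_of_lt hb hF
  obtain ⟨pb, hpb⟩ := hb.exists_le
  have key := PolyTime.natRec (S := S) hb (.nil e) hF' (fun _ => rfl) (fun _ _ => rfl) (by
    refine ⟨pb * (p + 1) + 1, fun y i hi => ?_⟩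
    rw [hS y i hi, size_ofList]
    have h := List.sum_le_card_nsmul
      (((List.range' (b y - i) i).map (F y)).map fun d => d.size + 1)
      (p.eval (e y).size + 1) (by
        intro x hx
        simp only [List.mem_map, List.mem_range'_1] at hx
        obtain ⟨_, ⟨l, hl, rfl⟩, rfl⟩ := hx
        have := hp y l (by omega)
        omega)
    simp only [List.length_map, List.length_range', smul_eq_mul] at h
    have h' := Nat.mul_le_mul_right (p.eval (e y).size + 1) (hi.trans (hpb y))
    simp only [Polynomial.eval_add, Polynomial.eval_mul, Polynomial.eval_one]
    omega)
  have h : ∀ y, S y (b y) = Datum.table (b y) (F y) := by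
    intro y
    rw [hS y _ le_rfl, Datum.table, List.range_eq_range', Nat.sub_self]
  simpa only [h] using key

namespace PolyTimeNat

variable {f f' : Y → ℕ}

/-- Bounded sums. -/
theorem sum {b : Y → ℕ} {F : Y → ℕ → ℕ} (hb : PolyTimeNat e b)
    (hF : PolyTimeNat (withNat e) fun z => F z.1 z.2) :
    PolyTimeNat e fun y => ∑ i ∈ Finset.range (b y), F y i := by
  obtain ⟨p, hp⟩ := PolyTime.exists_size_le_of_lt (F := fun y i => unary (F y i)) hb hF
  obtain ⟨pb, hpb⟩ := hb.exists_le
  refine PolyTime.natRec (S := fun y i => unary (∑ l ∈ Finset.range i, F y l))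
    (F := fun y i d => unary (d.len + F y i)) hb (.nil e)
    ((len (.lastD _)).add hF.liftD) (fun y => rfl)
    (fun y i => by simp [Finset.sum_range_succ]) ⟨2 * (pb * p) + 1, fun y i hi => ?_⟩
  have h1 : ∑ l ∈ Finset.range i, F y l ≤ i * p.eval (e y).size := by
    have := Finset.sum_le_card_nsmul (Finset.range i) (F y) (p.eval (e y).size) (by
      intro l hl
      have := hp y l (by simp at hl; omega)
      simp at this
      omega)
    simpa using this
  have h2 := Nat.mul_le_mul_right (p.eval (e y).size) (hi.trans (hpb y))
  simp only [size_unary, Polynomial.eval_add, Polynomial.eval_mul, Polynomial.eval_one,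
    Polynomial.eval_ofNat]
  omega

theorem mul (hf : PolyTimeNat e f) (hf' : PolyTimeNat e f') :
    PolyTimeNat e fun y => f y * f' y := by
  simpa using sum (F := fun y _ => f' y) hf hf'.lift

end PolyTimeNat

theorem PolyTime.ite_lt {f f' : Y → ℕ} {h : Y → Datum} (hf : PolyTimeNat e f)
    (hf' : PolyTimeNat e f') (hg : PolyTime e g) (hh : PolyTime e h) :
    PolyTime e fun y => if f y < f' y then g y else h y := by
  have : ∀ y, (if f y < f' y then g y else h y) = (unary (f' y - f y)).ifNode (g y) (h y) := by
    intro y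
    split_ifs with hlt
    · obtain ⟨m, hm⟩ := Nat.exists_eq_add_of_lt hlt
      rw [show f' y - f y = m + 1 by omega]; rfl
    · rw [show f' y - f y = 0 by omega]; rfl
  simpa only [this] using PolyTime.ifNode (hf'.sub hf) hg hh

theorem PolyTime.ite_eq {f f' : Y → ℕ} {h : Y → Datum} (hf : PolyTimeNat e f)
    (hf' : PolyTimeNat e f') (hg : PolyTime e g) (hh : PolyTime e h) :
    PolyTime e fun y => if f y = f' y then g y else h y := by
  have : ∀ y, (if f y = f' y then g y else h y) =
      if f y < f' y then h y else if f' y < f y then h y else g y := by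
    intro y
    split_ifs <;> first | rfl | omega
  simpa only [this] using PolyTime.ite_lt hf hf' hh (PolyTime.ite_lt hf' hf hh hg)

namespace PolyTimeNat

variable {f f' k k' : Y → ℕ}

theorem ite_lt (hf : PolyTimeNat e f) (hf' : PolyTimeNat e f') (hk : PolyTimeNat e k)
    (hk' : PolyTimeNat e k') : PolyTimeNat e fun y => if f y < f' y then k y else k' y := by
  have := PolyTime.ite_lt hf hf' hk hk'
  simpa only [← apply_ite unary] using this

theorem ite_eq (hf : PolyTimeNat e f) (hf' : PolyTimeNat e f') (hk : PolyTimeNat e k)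
    (hk' : PolyTimeNat e k') : PolyTimeNat e fun y => if f y = f' y then k y else k' y := by
  have := PolyTime.ite_eq hf hf' hk hk'
  simpa only [← apply_ite unary] using this

theorem min (hf : PolyTimeNat e f) (hf' : PolyTimeNat e f') :
    PolyTimeNat e fun y => Min.min (f y) (f' y) := by
  have : ∀ y, Min.min (f y) (f' y) = f y - (f y - f' y) := fun y => by omega
  simpa only [this] using hf.sub (hf.sub hf')

theorem div (hf : PolyTimeNat e f) (hf' : PolyTimeNat e f') :
    PolyTimeNat e fun y => f y / f' y := by
  have h : ∀ a b : ℕ, a / b =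
      ∑ i ∈ Finset.range a, if 0 < b then if a < (i + 1) * b then 0 else 1 else 0 := by
    intro a b
    rcases Nat.eq_zero_or_pos b with rfl | hb
    · simp
    · simp only [hb, if_true]
      rw [Finset.sum_ite, Finset.sum_const_zero, zero_add, Finset.sum_const, smul_eq_mul, mul_one]
      have : (Finset.range a).filter (fun i => ¬ a < (i + 1) * b) = Finset.range (a / b) := by
        ext i
        simp only [Finset.mem_filter, Finset.mem_range, not_lt, ← Nat.le_div_iff_mul_le hb]
        have := Nat.div_le_self a b
        omega
      rw [this, Finset.card_range]
  simp only [h]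
  exact sum hf (.ite_lt (.const _ 0) hf'.lift
    (.ite_lt hf.lift (((last e).add (.const _ 1)).mul hf'.lift) (.const _ 0) (.const _ 1))
    (.const _ 0))

theorem mod (hf : PolyTimeNat e f) (hf' : PolyTimeNat e f') :
    PolyTimeNat e fun y => f y % f' y := by
  simpa only [Nat.mod_eq_sub_mul_div] using hf.sub (hf'.mul (hf.div hf'))

end PolyTimeNat

end Recursion

/-! ### Comparing products of binary numbers -/

namespace Datum

/-- The bit with index `l` of a binary number. -/
def bit (x : Datum) (l : ℕ) : ℕ := (x.nth l).len

/-- The value of a binary number. -/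
def value (x : Datum) : ℕ := ∑ l ∈ Finset.range x.len, x.bit l * 2 ^ l

/-- The digits of the product of two binary numbers, without any carrying. -/
def mulDigit (x y : Datum) (k : ℕ) : ℕ := ∑ l ∈ Finset.range (k + 1), x.bit l * y.bit (k - l)

end Datum

/-- The carries in the subtraction of two numbers with digits `dp` and `dn` (not necessarily less
than `2`) to the base `2`: the carry into position `k` is the first component minus the second
one, and one of them vanishes. -/
def carry (dp dn : ℕ → ℕ) : ℕ → ℕ × ℕ
  | 0 => (0, 0)
  | k + 1 =>
    (((carry dp dn k).1 + dp k - ((carry dp dn k).2 + dn k)) / 2,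
      ((carry dp dn k).2 + dn k - ((carry dp dn k).1 + dp k) + 1) / 2)

/-- `1` if `∑ k < K, dn k * 2 ^ k ≤ ∑ k < K, dp k * 2 ^ k`, and `0` otherwise, decided from the
carries. -/
def digitsLE (K : ℕ) (dn dp : ℕ → ℕ) : ℕ := if (carry dp dn K).2 = 0 then 1 else 0

/-- `1` if `m * q ≤ M * r` for the encoded rationals `q` and `r`, and `0` otherwise. -/
def ratLE (m : ℕ) (q : Datum) (M : ℕ) (r : Datum) : ℕ :=
  digitsLE (q.left.len + q.right.len + r.left.len + r.right.len)
    (fun k => m * mulDigit q.left r.right k) fun k => M * mulDigit r.left q.right k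

section

variable {Y : Type} {e : Y → Datum}

theorem PolyTimeNat.bit {x : Y → Datum} {l : Y → ℕ} (hx : PolyTime e x) (hl : PolyTimeNat e l) :
    PolyTimeNat e fun y => (x y).bit (l y) := .len (hx.nth hl)

theorem PolyTimeNat.mulDigit {x x' : Y → Datum} {k : Y → ℕ} (hx : PolyTime e x)
    (hx' : PolyTime e x') (hk : PolyTimeNat e k) :
    PolyTimeNat e fun y => mulDigit (x y) (x' y) (k y) :=
  .sum (hk.add (.const e 1)) ((PolyTimeNat.bit hx.lift (.last e)).mul
    (.bit hx'.lift (hk.lift.sub (.last e))))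

theorem carry_le (dp dn : ℕ → ℕ) (k : ℕ) :
    (carry dp dn k).1 ≤ ∑ l ∈ Finset.range k, dp l ∧
      (carry dp dn k).2 ≤ ∑ l ∈ Finset.range k, dn l := by
  induction k with
  | zero => simp [carry]
  | succ k ih => simp only [carry, Finset.sum_range_succ]; omega

theorem PolyTimeNat.digitsLE {K : Y → ℕ} {dn dp : Y → ℕ → ℕ} (hK : PolyTimeNat e K)
    (hn : PolyTimeNat (withNat e) fun z => dn z.1 z.2)
    (hp : PolyTimeNat (withNat e) fun z => dp z.1 z.2) :
    PolyTimeNat e fun y => digitsLE (K y) (dn y) (dp y) := by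
  obtain ⟨q, hq⟩ := PolyTime.exists_size_le ((PolyTimeNat.sum hK hp).node (PolyTimeNat.sum hK hn))
  have hP : PolyTimeNat (withDatum (withNat e)) fun z => z.2.left.len + dp z.1.1 z.1.2 :=
    (PolyTimeNat.len (PolyTime.lastD _).left).add hp.liftD
  have hN : PolyTimeNat (withDatum (withNat e)) fun z => z.2.right.len + dn z.1.1 z.1.2 :=
    (PolyTimeNat.len (PolyTime.lastD _).right).add hn.liftD
  have h := PolyTime.natRec (b := K)
    (F := fun y k d => .node (unary ((d.left.len + dp y k - (d.right.len + dn y k)) / 2))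
      (unary ((d.right.len + dn y k - (d.left.len + dp y k) + 1) / 2)))
    (S := fun y k => .node (unary (carry (dp y) (dn y) k).1) (unary (carry (dp y) (dn y) k).2))
    hK (.const e (.node .nil .nil)) (((hP.sub hN).div (.const _ 2)).node
      (((hN.sub hP).add (.const _ 1)).div (.const _ 2))) (fun y => rfl)
    (fun y i => by simp [carry, left, right]) ⟨q, fun y i hi => (hq y).trans' (by
      have h := carry_le (dp y) (dn y) i
      have h1 : ∑ l ∈ Finset.range i, dp y l ≤ ∑ l ∈ Finset.range (K y), dp y l :=
        Finset.sum_le_sum_of_subset (by simpa using hi)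
      have h2 : ∑ l ∈ Finset.range i, dn y l ≤ ∑ l ∈ Finset.range (K y), dn y l :=
        Finset.sum_le_sum_of_subset (by simpa using hi)
      simp only [size, size_unary]
      omega)⟩
  exact PolyTimeNat.ite_eq h.right (.const e 0) (.const e 1) (.const e 0)

theorem PolyTimeNat.ratLE {m M : Y → ℕ} {q r : Y → Datum} (hm : PolyTimeNat e m)
    (hq : PolyTime e q) (hM : PolyTimeNat e M) (hr : PolyTime e r) :
    PolyTimeNat e fun y => ratLE (m y) (q y) (M y) (r y) :=
  .digitsLE ((((PolyTimeNat.len hq.left).add (.len hq.right)).add (.len hr.left)).add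
      (.len hr.right))
    (hm.lift.mul (.mulDigit hq.left.lift hr.right.lift (.last e)))
    (hM.lift.mul (.mulDigit hr.left.lift hq.right.lift (.last e)))

end

/-- The difference of the numbers formed by the first `k` digits is `2 ^ k` times the carry plus a
remainder in `[0, 2 ^ k)`. -/
theorem carry_spec (dp dn : ℕ → ℕ) (k : ℕ) :
    ((carry dp dn k).1 = 0 ∨ (carry dp dn k).2 = 0) ∧ ∃ r < 2 ^ k,
      ∑ l ∈ Finset.range k, dp l * 2 ^ l + 2 ^ k * (carry dp dn k).2 =
        ∑ l ∈ Finset.range k, dn l * 2 ^ l + 2 ^ k * (carry dp dn k).1 + r := by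
  induction k with
  | zero => simp [carry]
  | succ k ih =>
    obtain ⟨-, r, hr, h⟩ := ih
    simp only [carry, Finset.sum_range_succ]
    generalize (carry dp dn k).1 = c at *
    generalize (carry dp dn k).2 = d at *
    refine ⟨by omega, ?_⟩
    rcases le_total (d + dn k) (c + dp k) with hle | hle
    · have h2 : (d + dn k - (c + dp k) + 1) / 2 = 0 := by omega
      have h3 := Nat.div_add_mod (c + dp k - (d + dn k)) 2
      have h4 := Nat.mod_lt (c + dp k - (d + dn k)) (by norm_num : 0 < 2)
      generalize (c + dp k - (d + dn k)) / 2 = u at *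
      generalize (c + dp k - (d + dn k)) % 2 = b at *
      refine ⟨r + 2 ^ k * b, ?_, ?_⟩
      · rw [pow_succ]; nlinarith
      · rw [h2, pow_succ]
        have h5 : c + dp k = 2 * u + b + (d + dn k) := by omega
        have h6 : 2 ^ k * (c + dp k) = 2 ^ k * (2 * u + b + (d + dn k)) := by rw [h5]
        linarith
    · have h2 : (c + dp k - (d + dn k)) / 2 = 0 := by omega
      obtain ⟨b, hb, h3⟩ : ∃ b < 2, d + dn k - (c + dp k) + b =
          2 * ((d + dn k - (c + dp k) + 1) / 2) :=
        ⟨2 * ((d + dn k - (c + dp k) + 1) / 2) - (d + dn k - (c + dp k)), by omega, by omega⟩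
      generalize (d + dn k - (c + dp k) + 1) / 2 = u at *
      refine ⟨r + 2 ^ k * b, ?_, ?_⟩
      · rw [pow_succ]; nlinarith
      · rw [h2, pow_succ]
        have h5 : d + dn k + b = 2 * u + (c + dp k) := by omega
        have h6 : 2 ^ k * (d + dn k + b) = 2 ^ k * (2 * u + (c + dp k)) := by rw [h5]
        linarith

theorem digitsLE_eq (K : ℕ) (dn dp : ℕ → ℕ) :
    digitsLE K dn dp = if ∑ k ∈ Finset.range K, dn k * 2 ^ k ≤
      ∑ k ∈ Finset.range K, dp k * 2 ^ k then 1 else 0 := by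
  obtain ⟨h0, r, hr, h⟩ := carry_spec dp dn K
  unfold digitsLE
  congr 1
  rw [eq_iff_iff]
  constructor
  · intro h2
    rw [h2] at h
    omega
  · intro hle
    by_contra h2
    rw [h0.resolve_right h2] at h
    have : 2 ^ K * 1 ≤ 2 ^ K * (carry dp dn K).2 := Nat.mul_le_mul_left _ (by omega)
    omega

namespace Datum

theorem bit_eq_zero {x : Datum} {l : ℕ} (h : x.len ≤ l) : x.bit l = 0 := by
  have := len_iterate_right x l
  unfold bit nth
  revert this
  cases right^[l] x with
  | nil => intro _; rfl
  | node a b => simp only [len]; omega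

theorem sum_bit_mul {x : Datum} {K : ℕ} (h : x.len ≤ K) :
    ∑ l ∈ Finset.range K, x.bit l * 2 ^ l = x.value :=
  (Finset.sum_subset (by simpa using h) fun l _ hl => by
    rw [bit_eq_zero (by simpa using hl), zero_mul]).symm

theorem sum_mulDigit {x y : Datum} {K : ℕ} (h : x.len + y.len ≤ K) :
    ∑ k ∈ Finset.range K, mulDigit x y k * 2 ^ k = x.value * y.value := by
  have h1 : ∀ k, mulDigit x y k * 2 ^ k = ∑ l ∈ Finset.range (k + 1),
      (fun i j => x.bit i * 2 ^ i * (y.bit j * 2 ^ j)) l (k - l) := by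
    intro k
    rw [mulDigit, Finset.sum_mul]
    refine Finset.sum_congr rfl fun l hl => ?_
    have : 2 ^ k = 2 ^ l * 2 ^ (k - l) := by
      rw [← pow_add]; congr 1; simp at hl; omega
    rw [this]; ring
  simp only [h1]
  rw [Finset.sum_range_diag_flip K fun i j => x.bit i * 2 ^ i * (y.bit j * 2 ^ j), ← sum_bit_mul (x := x) (K := K) (by omega), Finset.sum_mul]
  refine Finset.sum_congr rfl fun l hl => ?_
  rw [← Finset.mul_sum]
  by_cases hl' : l < x.len
  · rw [sum_bit_mul (by omega)]
  · rw [bit_eq_zero (by omega)]; simp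

theorem value_node (a b : Datum) : (node a b).value = a.len + 2 * b.value := by
  rw [value, len, Finset.sum_range_succ', value, Finset.mul_sum, add_comm]
  congr 1
  · simp [bit, nth, left]
  · refine Finset.sum_congr rfl fun l _ => ?_
    simp only [bit, nth, Function.iterate_succ_apply, right]
    ring

@[simp] theorem value_ofNat (m : ℕ) : (ofNat m).value = m := by
  induction m using Nat.binaryRec' with
  | zero => rfl
  | bit b m h ih =>
    rw [ofNat, Nat.bits_append_bit _ _ h, List.map_cons, ofList, value_node, ← ofNat, ih]
    cases b <;> simp [ofBool, len, Nat.bit]; ring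

theorem len_ofNat_eq_zero {m : ℕ} : (ofNat m).len = 0 ↔ m = 0 := by
  constructor
  · intro h
    rw [← value_ofNat m, value, h]; rfl
  · rintro rfl; rfl

end Datum

theorem ratLE_eq (m : ℕ) (q : Datum) (M : ℕ) (r : Datum) :
    ratLE m q M r = if m * (q.left.value * r.right.value) ≤ M * (r.left.value * q.right.value)
      then 1 else 0 := by
  rw [ratLE, digitsLE_eq]
  simp only [mul_assoc]
  rw [← Finset.mul_sum, ← Finset.mul_sum, sum_mulDigit (by omega), sum_mulDigit (by omega)]

theorem ratLE_ofRat (m M : ℕ) {q r : ℚ} (hq : 0 ≤ q) (hr : 0 ≤ r) :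
    ratLE m (ofRat q) M (ofRat r) = if (m : ℚ) * q ≤ M * r then 1 else 0 := by
  rw [ratLE_eq]
  simp only [ofRat, left, right, value_ofNat]
  congr 1
  rw [eq_iff_iff]
  have hq' : q = (q.num.natAbs : ℚ) / q.den := by
    rw [Nat.cast_natAbs, abs_of_nonneg (Rat.num_nonneg.2 hq), Rat.num_div_den]
  have hr' : r = (r.num.natAbs : ℚ) / r.den := by
    rw [Nat.cast_natAbs, abs_of_nonneg (Rat.num_nonneg.2 hr), Rat.num_div_den]
  have h1 : (0 : ℚ) < q.den := by exact_mod_cast q.den_pos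
  have h2 : (0 : ℚ) < r.den := by exact_mod_cast r.den_pos
  conv_rhs => rw [hq', hr']
  rw [mul_div_assoc', mul_div_assoc', div_le_div_iff₀ h1 h2]
  norm_cast
  rw [mul_assoc, mul_assoc]

/-! ### The algorithm -/

section Input

variable (D : Datum)

/-- The number of players of the encoded game `D`. -/
def numPlayers : ℕ := D.left.left.len

/-- The number of strategies of player `i`. -/
def numStrats (i : ℕ) : ℕ := (D.left.left.nth i).len

/-- The name of strategy number `u` of player `i`. -/
def stratName (i u : ℕ) : Datum := ((D.left.left.nth i).nth u).left

/-- The payoff of the edge `{i, j}` for strategies number `u` and `v`. For `i = j` it is the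
individual preference of player `i` for strategy number `u`. -/
def entry (i j u v : ℕ) : Datum :=
  if i = j then ((D.left.left.nth i).nth u).right
  else (((D.left.right.nth i).nth j).right.nth u).nth v

/-- The value to which the largest payoff is scaled. -/
def scale : ℕ := 16 * (numPlayers D * numPlayers D * (numPlayers D * numPlayers D))

/-- The number of payoffs `q` of the game with `m * q > M * r`. -/
def numExceeding (m M : ℕ) (r : Datum) : ℕ :=
  ∑ i ∈ Finset.range (numPlayers D), ∑ j ∈ Finset.range (numPlayers D),
    ∑ u ∈ Finset.range (numStrats D i), ∑ v ∈ Finset.range (numStrats D j),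
      (1 - ratLE m (entry D i j u v) M r)

/-- The payoff `r`, scaled such that the largest payoff becomes `scale D`, and rounded down. -/
def rounded (r : Datum) : ℕ :=
  if r.left.len = 0 then 0
  else ∑ m ∈ Finset.range (scale D), (1 - numExceeding D (m + 1) (scale D) r)

/-- The total number of strategies of all players. -/
def numSlots : ℕ := ∑ i ∈ Finset.range (numPlayers D), numStrats D i

/-- The number of colours. A colour is the number of a pair of a player and a position in the list of
the strategies of this player. Hence several colours may denote the same strategy name; treating
them as different only decreases the welfare. -/
def numColours : ℕ := numPlayers D * numSlots D

/-- The strategy name that colour `c` denotes (the name `0` if the position is not occupied). -/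
def colourName (c : ℕ) : Datum := stratName D (c / numSlots D) (c % numSlots D)

/-- `1` if two binary numbers are equal, and `0` otherwise. -/
def sameName (x y : Datum) : ℕ :=
  if x.len = y.len then 1 - ∑ l ∈ Finset.range x.len, if x.bit l = y.bit l then 0 else 1 else 0

/-- The scaled and rounded payoff that `i` and `j` obtain from each other if both have colour `c`;
for `i = j` it is the individual preference. -/
def weight (i j c : ℕ) : ℕ :=
  ∑ u ∈ Finset.range (numStrats D i), ∑ v ∈ Finset.range (numStrats D j),
    if 0 < sameName (stratName D i u) (colourName D c) * sameName (stratName D j v) (colourName D c)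
    then rounded D (entry D i j u v) else 0

/-- The number of rounds of the play. -/
def horizon : ℕ := numColours D * (scale D * scale D)

end Input

/-- The first number below `m` at which `f` is maximal (`0` for `m = 0`). -/
def argmaxBelow (f : ℕ → ℕ) : ℕ → ℕ
  | 0 => 0
  | m + 1 => if f (argmaxBelow f m) < f m then m else argmaxBelow f m

section Solver

variable (W : ℕ → ℕ → ℕ → ℕ) (n L T : ℕ)

/-- The entry of a table that counts how often player `i` has chosen colour `c`. -/
def count (d : Datum) (i c : ℕ) : ℕ := ((d.nth i).nth c).len

/-- The marginal value of colour `c` for player `i`: every pair `i, j` splits `2 * W i j c` between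
its members, and the member that has chosen the colour less often receives more. -/
def load (d : Datum) (i c : ℕ) : ℕ :=
  ∑ j ∈ Finset.range n, min (W i j c + count d j c - count d i c) (2 * W i j c)

/-- The numbers of choices in a play in which in every round each player chooses a colour of
maximum load. -/
def counts : ℕ → Datum
  | 0 => .nil
  | r + 1 => table n fun i => table L fun c =>
    unary (count (counts r) i c + if c = argmaxBelow (load W n (counts r) i) L then 1 else 0)

/-- The payoff of the pair `i, j` in the fractional colouring given by `d`, times the number of
rounds. -/
def overlap (d : Datum) (i j : ℕ) : ℕ :=
  ∑ c ∈ Finset.range L, W i j c * min (count d i c) (count d j c)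

/-- The extent to which the choices of `i` and `j` agree. -/
def common (d : Datum) (i j : ℕ) : ℕ :=
  ∑ c ∈ Finset.range L, min (count d i c) (count d j c)

/-- The state of player `i` in a partial assignment: `c + 1` for colour `c`, and `0` for a player
without colour. -/
def assigned (a : Datum) (i : ℕ) : ℕ := (a.nth i).len

/-- The estimate for the welfare that will be reached from a partial assignment, multiplied by
`4 * T ^ 2`. With random colours and thresholds, a pair that is not coloured yet would obtain
`overlap / (2 * T - common)`, for which the estimate uses the first two terms of the geometric
series. -/
def estimate (d a : Datum) : ℕ :=
  ∑ i ∈ Finset.range n, ∑ j ∈ Finset.range n,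
    if assigned a i = 0 then
      if assigned a j = 0 then overlap W L d i j * (2 * T + common L d i j) else 0
    else if assigned a i = assigned a j then 4 * (T * T) * W i j (assigned a i - 1) else 0

/-- The estimate, with ties broken in favour of more assigned players. -/
def score (d a : Datum) : ℕ :=
  (n + 1) * estimate W n L T d a + ∑ i ∈ Finset.range n, if assigned a i = 0 then 0 else 1

/-- Colour `c` for all players without colour that have chosen it more than `t` times. -/
def extend (d a : Datum) (c t : ℕ) : Datum :=
  table n fun i => unary
    (if assigned a i = 0 then if t < count d i c then c + 1 else 0 else assigned a i)

def bestThreshold (d a : Datum) (c : ℕ) : ℕ :=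
  argmaxBelow (fun t => score W n L T d (extend n d a c t)) T

def bestColour (d a : Datum) : ℕ :=
  argmaxBelow (fun c => score W n L T d (extend n d a c (bestThreshold W n L T d a c))) L

/-- The extension of maximum score of a partial assignment. -/
def assignStep (d a : Datum) : Datum :=
  extend n d a (bestColour W n L T d a) (bestThreshold W n L T d a (bestColour W n L T d a))

/-- The partial assignment after some number of steps. -/
def assignment (d : Datum) : ℕ → Datum
  | 0 => .nil
  | r + 1 => assignStep W n L T d (assignment d r)

/-- The payoff of player `i` in the colouring `a`. -/
def colourPayoff (a : Datum) (i : ℕ) : ℕ :=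
  ∑ j ∈ Finset.range n, if assigned a i = assigned a j then W i j (assigned a i - 1) else 0

/-- The position of `i` in the order by decreasing value of `f`, with ties broken by index. -/
def rankBelow (f : ℕ → ℕ) (i : ℕ) : ℕ :=
  ∑ j ∈ Finset.range n,
    if f i < f j then 1 else if f i = f j then if j < i then 1 else 0 else 0

end Solver

section Output

variable (D : Datum)

/-- The colouring that the algorithm computes. -/
def colouring : Datum :=
  assignment (weight D) (numPlayers D) (numColours D) (horizon D)
    (counts (weight D) (numPlayers D) (numColours D) (horizon D)) (numPlayers D)

/-- The number of the strategy with the colour of player `i`, and `0` if there is none. -/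
def chosenStrat (a : Datum) (i : ℕ) : ℕ :=
  ∑ u ∈ Finset.range (numStrats D i),
    if 0 < sameName (stratName D i u) (colourName D (assigned a i - 1)) then u else 0

/-- `1` if player `i` is among the `k` players of highest payoff, where `k` is the second part of
the input, and `0` otherwise. The rank plus one is treated as a number with a single digit. -/
def selected (a : Datum) (i : ℕ) : ℕ :=
  digitsLE (D.right.len + 1)
    (fun l => if l = 0 then rankBelow (numPlayers D) (colourPayoff (weight D) (numPlayers D) a) i + 1
      else 0) D.right.bit

/-- The output of the algorithm. -/
def imposition : Datum :=
  table (numPlayers D) fun i =>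
    if 0 < selected D (colouring D) i then
      .node .nil (stratName D i (chosenStrat D (colouring D) i))
    else .nil

end Output

/-! ### The running time of the algorithm -/

theorem argmaxBelow_le (f : ℕ → ℕ) (m : ℕ) : argmaxBelow f m ≤ m := by
  induction m with
  | zero => rfl
  | succ m ih => rw [argmaxBelow]; split_ifs <;> omega

theorem Datum.size_table_mono {m : ℕ} {f g : ℕ → Datum} (h : ∀ i < m, (f i).size ≤ (g i).size) :
    (table m f).size ≤ (table m g).size := by
  rw [table, table, size_ofList, size_ofList, List.map_map, List.map_map]
  gcongr 1
  refine List.sum_le_sum fun i hi => ?_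
  have := h i (by simpa using hi)
  simpa using this

theorem count_table {n L i c : ℕ} (f : ℕ → ℕ → ℕ) (hi : i < n) (hc : c < L) :
    count (table n fun i => table L fun c => unary (f i c)) i c = f i c := by
  rw [count, nth_table _ hi, nth_table _ hc, len_unary]

theorem assigned_table {n i : ℕ} (f : ℕ → ℕ) (hi : i < n) :
    assigned (table n fun i => unary (f i)) i = f i := by
  rw [assigned, nth_table _ hi, len_unary]

theorem count_nil (i c : ℕ) : count .nil i c = 0 := by simp [count, nth_nil, len]

theorem assigned_nil (i : ℕ) : assigned .nil i = 0 := by simp [assigned, nth_nil, len]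

theorem count_counts_succ (W : ℕ → ℕ → ℕ → ℕ) {n L : ℕ} (r : ℕ) {i c : ℕ} (hi : i < n)
    (hc : c < L) : count (counts W n L (r + 1)) i c =
      count (counts W n L r) i c +
        if c = argmaxBelow (load W n (counts W n L r) i) L then 1 else 0 :=
  count_table (fun i c => count (counts W n L r) i c +
    if c = argmaxBelow (load W n (counts W n L r) i) L then 1 else 0) hi hc

theorem count_counts_le (W : ℕ → ℕ → ℕ → ℕ) {n L : ℕ} (r : ℕ) {i c : ℕ} (hi : i < n)
    (hc : c < L) : count (counts W n L r) i c ≤ r := by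
  induction r with
  | zero => simp [counts, count_nil]
  | succ r ih => rw [count_counts_succ W r hi hc]; split_ifs <;> omega

theorem size_counts_le (W : ℕ → ℕ → ℕ → ℕ) (n L : ℕ) {r T : ℕ} (hr : r ≤ T) :
    (counts W n L r).size ≤ (table n fun _ => table L fun _ => unary T).size := by
  cases r with
  | zero => exact Datum.size_pos _
  | succ r =>
    refine size_table_mono fun i hi => size_table_mono fun c hc => ?_
    have := count_counts_le W r hi hc
    simp only [size_unary]
    split_ifs <;> omega

theorem assigned_extend {n : ℕ} (d a : Datum) (c t : ℕ) {i : ℕ} (hi : i < n) :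
    assigned (extend n d a c t) i =
      if assigned a i = 0 then if t < count d i c then c + 1 else 0 else assigned a i :=
  assigned_table (fun i =>
    if assigned a i = 0 then if t < count d i c then c + 1 else 0 else assigned a i) hi

theorem assigned_assignment_le (W : ℕ → ℕ → ℕ → ℕ) {n : ℕ} (L T : ℕ) (d : Datum) (r : ℕ) {i : ℕ}
    (hi : i < n) : assigned (assignment W n L T d r) i ≤ L + 1 := by
  induction r with
  | zero => simp [assignment, assigned_nil]
  | succ r ih =>
    have : bestColour W n L T d (assignment W n L T d r) ≤ L := argmaxBelow_le _ _
    rw [assignment, assignStep, assigned_extend _ _ _ _ hi]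
    split_ifs <;> omega

theorem size_assignment_le (W : ℕ → ℕ → ℕ → ℕ) (n L T : ℕ) (d : Datum) (r : ℕ) :
    (assignment W n L T d r).size ≤ (table n fun _ => unary (L + 1)).size := by
  cases r with
  | zero => exact Datum.size_pos _
  | succ r =>
    refine size_table_mono fun i hi => ?_
    have := assigned_assignment_le W L T d (r + 1) hi
    rw [assignment, assignStep, assigned_extend _ _ _ _ hi] at this
    simp only [size_unary]
    omega

section PolyTime

variable {Y Z : Type} {e : Y → Datum}

/-- Substitution for the last variable. -/
theorem PolyTime.subst {g : Z → Datum} {π : Z → Y} {i : Z → ℕ} {F : Y → ℕ → Datum}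
    (hF : PolyTime (withNat e) fun z => F z.1 z.2) (hπ : PolyTime g fun z => e (π z))
    (hi : PolyTimeNat g i) : PolyTime g fun z => F (π z) (i z) :=
  PolyTime.comp (g := fun z => withNat e (π z, i z)) (hπ.node hi)
    (hF.reindex fun z => (π z, i z))

namespace PolyTimeNat

theorem argmaxBelow {F : Y → ℕ → ℕ} {m : Y → ℕ} (hF : PolyTimeNat (withNat e) fun z => F z.1 z.2)
    (hm : PolyTimeNat e m) : PolyTimeNat e fun y => argmaxBelow (F y) (m y) := by
  have hlen : PolyTimeNat (withDatum (withNat e)) fun z => z.2.len := .len (.lastD _)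
  have h1 : PolyTimeNat (withDatum (withNat e)) fun z => F z.1.1 z.2.len :=
    PolyTime.subst (F := fun y i => unary (F y i)) (π := fun z : (Y × ℕ) × Datum => z.1.1) hF
      (PolyTime.refl e).lift.liftD hlen
  obtain ⟨q, hq⟩ := PolyTime.exists_size_le hm
  refine PolyTime.natRec (S := fun y i => unary (_root_.argmaxBelow (F y) i))
    (F := fun y i d => unary (if F y d.len < F y i then i else d.len)) hm (.nil e)
    (ite_lt h1 hF.liftD (PolyTimeNat.last e).liftD hlen) (fun y => rfl)
    (fun y i => by simp [_root_.argmaxBelow]) ⟨q, fun y i hi => (hq y).trans' ?_⟩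
  have := argmaxBelow_le (F y) i
  simp only [size_unary]
  omega

variable {D d a r : Y → Datum} {i j c u v t m M : Y → ℕ}

theorem numPlayers (hD : PolyTime e D) : PolyTimeNat e fun y => numPlayers (D y) :=
  .len hD.left.left

theorem numStrats (hD : PolyTime e D) (hi : PolyTimeNat e i) :
    PolyTimeNat e fun y => numStrats (D y) (i y) :=
  .len (hD.left.left.nth hi)

theorem _root_.PolyTime.stratName (hD : PolyTime e D) (hi : PolyTimeNat e i)
    (hu : PolyTimeNat e u) : PolyTime e fun y => stratName (D y) (i y) (u y) :=
  ((hD.left.left.nth hi).nth hu).left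

theorem _root_.PolyTime.entry (hD : PolyTime e D) (hi : PolyTimeNat e i) (hj : PolyTimeNat e j)
    (hu : PolyTimeNat e u) (hv : PolyTimeNat e v) :
    PolyTime e fun y => entry (D y) (i y) (j y) (u y) (v y) :=
  .ite_eq hi hj ((hD.left.left.nth hi).nth hu).right
    ((((hD.left.right.nth hi).nth hj).right.nth hu).nth hv)

theorem scale (hD : PolyTime e D) : PolyTimeNat e fun y => scale (D y) :=
  (const e 16).mul (((numPlayers hD).mul (numPlayers hD)).mul
    ((numPlayers hD).mul (numPlayers hD)))

theorem numExceeding (hD : PolyTime e D) (hm : PolyTimeNat e m) (hM : PolyTimeNat e M)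
    (hr : PolyTime e r) : PolyTimeNat e fun y => numExceeding (D y) (m y) (M y) (r y) :=
  .sum (numPlayers hD) (.sum (numPlayers hD.lift) (.sum (numStrats hD.lift.lift (last e).lift)
    (.sum (numStrats hD.lift.lift.lift (last _).lift) ((const _ 1).sub
      (.ratLE hm.lift.lift.lift.lift
        (.entry hD.lift.lift.lift.lift (last _).lift.lift.lift (last _).lift.lift (last _).lift
          (last _))
        hM.lift.lift.lift.lift hr.lift.lift.lift.lift)))))

theorem rounded (hD : PolyTime e D) (hr : PolyTime e r) :
    PolyTimeNat e fun y => rounded (D y) (r y) :=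
  .ite_eq (.len hr.left) (.const e 0) (.const e 0)
    (.sum (scale hD) ((const _ 1).sub (numExceeding hD.lift ((last e).add (.const _ 1))
      (scale hD).lift hr.lift)))

theorem numSlots (hD : PolyTime e D) : PolyTimeNat e fun y => numSlots (D y) :=
  .sum (numPlayers hD) (numStrats hD.lift (last e))

theorem numColours (hD : PolyTime e D) : PolyTimeNat e fun y => numColours (D y) :=
  (numPlayers hD).mul (numSlots hD)

theorem _root_.PolyTime.colourName (hD : PolyTime e D) (hc : PolyTimeNat e c) :
    PolyTime e fun y => colourName (D y) (c y) :=
  .stratName hD (hc.div (numSlots hD)) (hc.mod (numSlots hD))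

theorem sameName {x x' : Y → Datum} (hx : PolyTime e x) (hx' : PolyTime e x') :
    PolyTimeNat e fun y => sameName (x y) (x' y) :=
  .ite_eq (.len hx) (.len hx')
    ((const e 1).sub (.sum (.len hx) (.ite_eq (.bit hx.lift (last e)) (.bit hx'.lift (last e))
      (.const _ 0) (.const _ 1)))) (.const e 0)

theorem weight (hD : PolyTime e D) (hi : PolyTimeNat e i) (hj : PolyTimeNat e j)
    (hc : PolyTimeNat e c) : PolyTimeNat e fun y => weight (D y) (i y) (j y) (c y) :=
  .sum (numStrats hD hi) (.sum (numStrats hD.lift hj.lift)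
    (.ite_lt (.const _ 0)
      ((sameName (.stratName hD.lift.lift hi.lift.lift (last _).lift)
          (.colourName hD.lift.lift hc.lift.lift)).mul
        (sameName (.stratName hD.lift.lift hj.lift.lift (last _))
          (.colourName hD.lift.lift hc.lift.lift)))
      (rounded hD.lift.lift (.entry hD.lift.lift hi.lift.lift hj.lift.lift (last _).lift (last _)))
      (.const _ 0)))

theorem horizon (hD : PolyTime e D) : PolyTimeNat e fun y => horizon (D y) :=
  (numColours hD).mul ((scale hD).mul (scale hD))

theorem count (hd : PolyTime e d) (hi : PolyTimeNat e i) (hc : PolyTimeNat e c) :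
    PolyTimeNat e fun y => count (d y) (i y) (c y) :=
  .len ((hd.nth hi).nth hc)

theorem load (hD : PolyTime e D) (hd : PolyTime e d) (hi : PolyTimeNat e i)
    (hc : PolyTimeNat e c) :
    PolyTimeNat e fun y => load (_root_.weight (D y)) (_root_.numPlayers (D y)) (d y) (i y) (c y) :=
  have hW := weight hD.lift hi.lift (last e) hc.lift
  .sum (numPlayers hD) (.min ((hW.add (count hd.lift (last e) hc.lift)).sub
    (count hd hi hc).lift) ((const _ 2).mul hW))

theorem _root_.PolyTime.counts (hD : PolyTime e D) :
    PolyTime e fun y => counts (_root_.weight (D y)) (_root_.numPlayers (D y))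
      (_root_.numColours (D y)) (_root_.horizon (D y)) := by
  have hn := numPlayers hD
  have hL := numColours hD
  have hd := PolyTime.lastD (withNat e)
  obtain ⟨q, hq⟩ := PolyTime.exists_size_le
    (PolyTime.table (F := fun y _ => table (_root_.numColours (D y)) fun _ =>
        unary (_root_.horizon (D y))) hn
      (PolyTime.table (F := fun z _ => unary (_root_.horizon (D z.1))) hL.lift
        (horizon hD).lift.lift))
  exact PolyTime.natRec
    (S := fun y r => _root_.counts (_root_.weight (D y)) (_root_.numPlayers (D y))
      (_root_.numColours (D y)) r)
    (F := fun y _ d => table (_root_.numPlayers (D y)) fun i =>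
      table (_root_.numColours (D y)) fun c => unary (_root_.count d i c +
        if c = _root_.argmaxBelow (_root_.load (_root_.weight (D y)) (_root_.numPlayers (D y)) d i)
          (_root_.numColours (D y)) then 1 else 0))
    (horizon hD) (.nil e)
    (.table hn.lift.liftD (.table hL.lift.liftD.lift
      ((count hd.lift.lift (last _).lift (last _)).add
        (ite_eq (last _)
          (argmaxBelow (load hD.lift.liftD.lift.lift.lift hd.lift.lift.lift (last _).lift.lift
            (last _)) hL.lift.liftD.lift.lift) (.const _ 1) (.const _ 0)))))
    (fun _ => rfl) (fun _ _ => rfl)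
    ⟨q, fun y r hr => (size_counts_le _ _ _ hr).trans (hq y)⟩

theorem overlap (hD : PolyTime e D) (hd : PolyTime e d) (hi : PolyTimeNat e i)
    (hj : PolyTimeNat e j) :
    PolyTimeNat e fun y => overlap (_root_.weight (D y)) (_root_.numColours (D y)) (d y) (i y)
      (j y) :=
  .sum (numColours hD) ((weight hD.lift hi.lift hj.lift (last e)).mul
    (.min (count hd.lift hi.lift (last e)) (count hd.lift hj.lift (last e))))

theorem common (hD : PolyTime e D) (hd : PolyTime e d) (hi : PolyTimeNat e i)
    (hj : PolyTimeNat e j) :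
    PolyTimeNat e fun y => common (_root_.numColours (D y)) (d y) (i y) (j y) :=
  .sum (numColours hD) (.min (count hd.lift hi.lift (last e)) (count hd.lift hj.lift (last e)))

theorem assigned (ha : PolyTime e a) (hi : PolyTimeNat e i) :
    PolyTimeNat e fun y => assigned (a y) (i y) :=
  .len (ha.nth hi)

theorem estimate (hD : PolyTime e D) (hd : PolyTime e d) (ha : PolyTime e a) :
    PolyTimeNat e fun y => estimate (_root_.weight (D y)) (_root_.numPlayers (D y))
      (_root_.numColours (D y)) (_root_.horizon (D y)) (d y) (a y) :=
  have hD' := hD.lift.lift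
  have hd' := hd.lift.lift
  have hi := (last e).lift
  have hj := last (withNat e)
  have hai := assigned ha.lift.lift hi
  have haj := assigned ha.lift.lift hj
  have hT := horizon hD'
  .sum (numPlayers hD) (.sum (numPlayers hD).lift
    (.ite_eq hai (.const _ 0)
      (.ite_eq haj (.const _ 0)
        ((overlap hD' hd' hi hj).mul (((const _ 2).mul hT).add (common hD' hd' hi hj)))
        (.const _ 0))
      (.ite_eq hai haj (((const _ 4).mul (hT.mul hT)).mul
        (weight hD' hi hj (hai.sub (.const _ 1)))) (.const _ 0))))

theorem score (hD : PolyTime e D) (hd : PolyTime e d) (ha : PolyTime e a) :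
    PolyTimeNat e fun y => score (_root_.weight (D y)) (_root_.numPlayers (D y))
      (_root_.numColours (D y)) (_root_.horizon (D y)) (d y) (a y) :=
  (((numPlayers hD).add (.const e 1)).mul (estimate hD hd ha)).add
    (.sum (numPlayers hD) (.ite_eq (assigned ha.lift (last e)) (.const _ 0) (.const _ 0)
      (.const _ 1)))

theorem _root_.PolyTime.extend (hD : PolyTime e D) (hd : PolyTime e d) (ha : PolyTime e a)
    (hc : PolyTimeNat e c) (ht : PolyTimeNat e t) :
    PolyTime e fun y => extend (_root_.numPlayers (D y)) (d y) (a y) (c y) (t y) :=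
  have hai := assigned ha.lift (last e)
  .table (numPlayers hD) (ite_eq hai (.const _ 0)
    (.ite_lt ht.lift (count hd.lift (last e) hc.lift) (hc.lift.add (.const _ 1)) (.const _ 0)) hai)

theorem bestThreshold (hD : PolyTime e D) (hd : PolyTime e d) (ha : PolyTime e a)
    (hc : PolyTimeNat e c) :
    PolyTimeNat e fun y => bestThreshold (_root_.weight (D y)) (_root_.numPlayers (D y))
      (_root_.numColours (D y)) (_root_.horizon (D y)) (d y) (a y) (c y) :=
  .argmaxBelow (score hD.lift hd.lift (.extend hD.lift hd.lift ha.lift hc.lift (last e)))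
    (horizon hD)

theorem bestColour (hD : PolyTime e D) (hd : PolyTime e d) (ha : PolyTime e a) :
    PolyTimeNat e fun y => bestColour (_root_.weight (D y)) (_root_.numPlayers (D y))
      (_root_.numColours (D y)) (_root_.horizon (D y)) (d y) (a y) :=
  .argmaxBelow (score hD.lift hd.lift (.extend hD.lift hd.lift ha.lift (last e)
    (bestThreshold hD.lift hd.lift ha.lift (last e)))) (numColours hD)

theorem _root_.PolyTime.colouring (hD : PolyTime e D) :
    PolyTime e fun y => colouring (D y) := by
  have hn := numPlayers hD
  have hD' := hD.lift.liftD
  have hd := (PolyTime.counts hD).lift.liftD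
  have ha := PolyTime.lastD (withNat e)
  obtain ⟨q, hq⟩ := PolyTime.exists_size_le
    (PolyTime.table (F := fun y _ => unary (_root_.numColours (D y) + 1)) hn
      ((numColours hD).lift.add (.const _ 1)))
  have hc := bestColour hD' hd ha
  exact PolyTime.natRec
    (F := fun y _ a => assignStep (_root_.weight (D y)) (_root_.numPlayers (D y))
      (_root_.numColours (D y)) (_root_.horizon (D y)) (_root_.counts (_root_.weight (D y))
        (_root_.numPlayers (D y)) (_root_.numColours (D y)) (_root_.horizon (D y))) a)
    (S := fun y r => assignment (_root_.weight (D y)) (_root_.numPlayers (D y))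
      (_root_.numColours (D y)) (_root_.horizon (D y)) (_root_.counts (_root_.weight (D y))
        (_root_.numPlayers (D y)) (_root_.numColours (D y)) (_root_.horizon (D y))) r)
    hn (.nil e) (.extend hD' hd ha hc (bestThreshold hD' hd ha hc))
    (fun _ => rfl) (fun _ _ => rfl)
    ⟨q, fun y r _ => (size_assignment_le _ _ _ _ _ _).trans (hq y)⟩

theorem colourPayoff (hD : PolyTime e D) (ha : PolyTime e a) (hi : PolyTimeNat e i) :
    PolyTimeNat e fun y => colourPayoff (_root_.weight (D y)) (_root_.numPlayers (D y)) (a y)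
      (i y) :=
  have hai := assigned ha.lift hi.lift
  .sum (numPlayers hD) (.ite_eq hai (assigned ha.lift (last e))
    (weight hD.lift hi.lift (last e) (hai.sub (.const _ 1))) (.const _ 0))

theorem selected (hD : PolyTime e D) (ha : PolyTime e a) (hi : PolyTimeNat e i) :
    PolyTimeNat e fun y => selected (D y) (a y) (i y) :=
  have hp := colourPayoff hD.lift ha.lift hi.lift
  have hq := colourPayoff hD.lift ha.lift (last e)
  have hrank : PolyTimeNat e fun y => rankBelow (_root_.numPlayers (D y))
      (_root_.colourPayoff (_root_.weight (D y)) (_root_.numPlayers (D y)) (a y)) (i y) :=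
    .sum (numPlayers hD) (.ite_lt hp hq (.const _ 1) (.ite_eq hp hq
      (.ite_lt (last e) hi.lift (.const _ 1) (.const _ 0)) (.const _ 0)))
  .digitsLE ((len hD.right).add (.const e 1))
    (.ite_eq (last e) (.const _ 0) (hrank.lift.add (.const _ 1)) (.const _ 0))
    (.bit hD.lift.right (last e))

theorem chosenStrat (hD : PolyTime e D) (ha : PolyTime e a) (hi : PolyTimeNat e i) :
    PolyTimeNat e fun y => chosenStrat (D y) (a y) (i y) :=
  .sum (numStrats hD hi) (.ite_lt (.const _ 0)
    (sameName (.stratName hD.lift hi.lift (last e))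
      (.colourName hD.lift ((assigned ha.lift hi.lift).sub (.const _ 1)))) (last e) (.const _ 0))

end PolyTimeNat

theorem PolyTime.imposition {D : Y → Datum} (hD : PolyTime e D) :
    PolyTime e fun y => imposition (D y) :=
  have ha := hD.colouring.lift
  .table (.numPlayers hD) (.ite_lt (.const _ 0) (.selected hD.lift ha (.last e))
    ((PolyTime.nil _).node
      (.stratName hD.lift (.last e) (.chosenStrat hD.lift ha (.last e)))) (.nil _))

end PolyTime

/-! ### Colourings and fractional colourings -/

section Fractional

variable (W : ℕ → ℕ → ℕ → ℕ) (n L T : ℕ)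

/-- The welfare of a colouring: all ordered pairs of equal colour contribute. -/
def colourWelfare (s : ℕ → ℕ) : ℕ :=
  ∑ i ∈ Finset.range n, ∑ j ∈ Finset.range n, if s i = s j then W i j (s i) else 0

/-- The Huber function, scaled by `2`: a smooth and convex substitute for `2 * w * |x|`. -/
def huber (w x : ℤ) : ℤ := if |x| ≤ w then x ^ 2 else 2 * w * |x| - w ^ 2

/-- A smooth substitute for `4 * w * min a b`. -/
def smoothMin (w a b : ℤ) : ℤ := 2 * w * (a + b) - huber w (a - b)

theorem huber_neg (w x : ℤ) : huber w (-x) = huber w x := by simp [huber]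

theorem le_huber (w x : ℤ) : 2 * w * |x| - w ^ 2 ≤ huber w x := by
  unfold huber
  split_ifs
  · nlinarith [sq_nonneg (|x| - w), sq_abs x]
  · exact le_rfl

theorem huber_add_one_le {w : ℤ} (hw : 0 ≤ w) (x : ℤ) :
    huber w (x + 1) ≤ huber w x + 2 * max (-w) (min w x) + 1 := by
  unfold huber
  rcases le_total 0 x with hx | hx
  · rw [abs_of_nonneg hx, abs_of_nonneg (by omega : 0 ≤ x + 1), max_eq_right (by omega)]
    rcases lt_trichotomy x w with h | h | h
    · rw [if_pos (by omega), if_pos (by omega), min_eq_right h.le]; nlinarith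
    · subst h; rw [if_neg (by omega), if_pos (by omega), min_self]; nlinarith
    · rw [if_neg (by omega), if_neg (by omega), min_eq_left h.le]; nlinarith
  · rcases hx.lt_or_eq with hx | rfl
    · rw [abs_of_neg hx, abs_of_nonpos (by omega : x + 1 ≤ 0), min_eq_right (by omega)]
      rcases lt_trichotomy (-x) (w + 1) with h | h | h
      · rw [if_pos (by omega), if_pos (by omega), max_eq_right (by omega)]; nlinarith
      · obtain rfl : w = -x - 1 := by omega
        rw [if_pos (by omega), if_neg (by omega), max_eq_left (by omega)]; nlinarith
      · rw [if_neg (by omega), if_neg (by omega), max_eq_left (by omega)]; nlinarith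
    · rcases hw.lt_or_eq with h | rfl
      · norm_num
        rw [if_pos (by omega), if_pos (by omega), min_eq_right (by omega), max_eq_right (by omega)]
        norm_num
      · norm_num

theorem smoothMin_le (w a b : ℕ) : smoothMin w a b ≤ 4 * (w * min a b : ℕ) + (w : ℤ) ^ 2 := by
  have h := le_huber w ((a : ℤ) - b)
  have h2 : (w : ℤ) * (a + b) = w * (2 * min a b + |(a : ℤ) - b|) := by
    congr 1
    rcases le_total a b with hab | hab
    · rw [abs_of_nonpos (by omega), min_eq_left (by omega)]; ring
    · rw [abs_of_nonneg (by omega), min_eq_right (by omega)]; ring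
  unfold smoothMin
  push_cast at h2 ⊢
  linarith

/-- The smooth substitute has the loads as its partial derivatives, up to a factor `2` and an error
of `1`. -/
theorem le_smoothMin_sub (w a b : ℕ) (x y : Prop) [Decidable x] [Decidable y] :
    2 * (if x then ((min (w + b - a) (2 * w) : ℕ) : ℤ) else 0) +
        2 * (if y then ((min (w + a - b) (2 * w) : ℕ) : ℤ) else 0) -
        ((if x then 1 else 0) + (if y then 1 else 0)) ≤
      smoothMin w (a + if x then 1 else 0 : ℕ) (b + if y then 1 else 0 : ℕ) - smoothMin w a b := by
  have h1 := huber_add_one_le (w := w) (by omega) ((a : ℤ) - b)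
  have h2 := huber_add_one_le (w := w) (by omega) ((b : ℤ) - a)
  rw [← huber_neg, ← huber_neg _ (b - a)] at h2
  have e1 : -((b : ℤ) - a + 1) = a - (b + 1) := by ring
  have e2 : -((b : ℤ) - a) = a - b := by ring
  have e3 : (a : ℤ) - b + 1 = a + 1 - b := by ring
  rw [e1, e2] at h2
  rw [e3] at h1
  unfold smoothMin
  split_ifs
  · have e4 : ((a : ℤ) + 1) - (b + 1) = a - b := by ring
    push_cast
    rw [e4]
    have : min ((w + b - a : ℕ) : ℤ) (2 * w) + min ((w + a - b : ℕ) : ℤ) (2 * w) ≤ 2 * w := by omega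
    linarith
  · have : ((min (w + b - a) (2 * w) : ℕ) : ℤ) = w - max (-(w : ℤ)) (min w (a - b)) := by omega
    rw [this]
    push_cast
    simp only [add_zero]
    linarith
  · have : ((min (w + a - b) (2 * w) : ℕ) : ℤ) = w - max (-(w : ℤ)) (min w (b - a)) := by omega
    rw [this]
    push_cast
    simp only [add_zero]
    linarith
  · simp

theorem le_argmaxBelow (f : ℕ → ℕ) {m i : ℕ} (hi : i < m) : f i ≤ f (argmaxBelow f m) := by
  induction m with
  | zero => omega
  | succ m ih =>
    rw [argmaxBelow]
    split_ifs with h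
    · rcases Nat.lt_succ_iff_lt_or_eq.1 hi with h' | rfl
      · exact (ih h').trans h.le
      · exact le_rfl
    · rcases Nat.lt_succ_iff_lt_or_eq.1 hi with h' | rfl
      · exact ih h'
      · exact not_lt.1 h

theorem argmaxBelow_lt (f : ℕ → ℕ) {m : ℕ} (hm : 0 < m) : argmaxBelow f m < m := by
  induction m with
  | zero => omega
  | succ m ih =>
    rw [argmaxBelow]
    split_ifs
    · omega
    · rcases m.eq_zero_or_pos with rfl | h
      · simp [argmaxBelow]
      · have := ih h; omega

variable {W n L} {M : ℕ} (hW : ∀ i < n, ∀ j < n, ∀ c, W i j c = W j i c)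

include hW in
/-- Weak duality: whatever the splits, the loads of the colours of a colouring sum up to at least
its welfare. -/
theorem colourWelfare_le_sum_load (d : Datum) (s : ℕ → ℕ) :
    colourWelfare W n s ≤ ∑ i ∈ Finset.range n, load W n d i (s i) := by
  have h1 : 2 * ∑ i ∈ Finset.range n, load W n d i (s i) =
      ∑ i ∈ Finset.range n, ∑ j ∈ Finset.range n,
        (min (W i j (s i) + count d j (s i) - count d i (s i)) (2 * W i j (s i)) +
          min (W j i (s j) + count d i (s j) - count d j (s j)) (2 * W j i (s j))) := by
    simp only [Finset.sum_add_distrib]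
    rw [Finset.sum_comm (f := fun i j =>
      min (W j i (s j) + count d i (s j) - count d j (s j)) (2 * W j i (s j))), two_mul]
    rfl
  have h2 : 2 * colourWelfare W n s ≤ 2 * ∑ i ∈ Finset.range n, load W n d i (s i) := by
    rw [h1, colourWelfare, Finset.mul_sum]
    refine Finset.sum_le_sum fun i hi => ?_
    rw [Finset.mul_sum]
    refine Finset.sum_le_sum fun j hj => ?_
    split_ifs with h
    · rw [← h, hW j (by simpa using hj) i (by simpa using hi)]
      omega
    · omega
  omega

/-- The potential that increases in the play. -/
def potential (W : ℕ → ℕ → ℕ → ℕ) (n L : ℕ) (d : Datum) : ℤ :=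
  ∑ i ∈ Finset.range n, ∑ j ∈ Finset.range n, ∑ c ∈ Finset.range L,
    smoothMin (W i j c) (count d i c) (count d j c)

include hW in
theorem potential_counts_succ (hL : 0 < L) (r : ℕ) (s : ℕ → ℕ) (hs : ∀ i < n, s i < L) :
    potential W n L (counts W n L r) + (4 * colourWelfare W n s - 2 * n ^ 2) ≤
      potential W n L (counts W n L (r + 1)) := by
  set d := counts W n L r
  let b : ℕ → ℕ := fun i => argmaxBelow (load W n d i) L
  have hb : ∀ i, b i < L := fun i => argmaxBelow_lt _ hL
  have hload : colourWelfare W n s ≤ ∑ i ∈ Finset.range n, load W n d i (b i) :=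
    (colourWelfare_le_sum_load hW d s).trans (Finset.sum_le_sum fun i hi =>
      le_argmaxBelow _ (hs i (by simpa using hi)))
  let y : ℕ → ℕ → ℕ → ℕ := fun i j c => min (W i j c + count d j c - count d i c) (2 * W i j c)
  have hy : ∀ i j c, y i j c = min (W i j c + count d j c - count d i c) (2 * W i j c) :=
    fun _ _ _ => rfl
  have h1 : ∀ i ∈ Finset.range n, ∀ j ∈ Finset.range n,
      2 * (y i j (b i) : ℤ) + 2 * (y j i (b j) : ℤ) - 2 ≤ ∑ c ∈ Finset.range L,
        (smoothMin (W i j c) (count (counts W n L (r + 1)) i c) (count (counts W n L (r + 1)) j c) -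
          smoothMin (W i j c) (count d i c) (count d j c)) := by
    intro i hi j hj
    have hi' : i < n := by simpa using hi
    have hj' : j < n := by simpa using hj
    have h2 : 2 * (y i j (b i) : ℤ) + 2 * (y j i (b j) : ℤ) - 2 = ∑ c ∈ Finset.range L,
        (2 * (if c = b i then (y i j c : ℤ) else 0) + 2 * (if c = b j then (y j i c : ℤ) else 0) -
          ((if c = b i then 1 else 0) + (if c = b j then 1 else 0))) := by
      simp only [Finset.sum_sub_distrib, Finset.sum_add_distrib, ← Finset.mul_sum,
        Finset.sum_ite_eq', Finset.mem_range, hb, if_true]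
      norm_num
    rw [h2]
    refine Finset.sum_le_sum fun c hc => ?_
    rw [count_counts_succ W r hi' (by simpa using hc), count_counts_succ W r hj' (by simpa using hc)]
    have := le_smoothMin_sub (W i j c) (count d i c) (count d j c) (c = b i) (c = b j)
    rw [← hy] at this
    rw [hy j i, hW j hj' i hi']
    exact this
  have h3 := Finset.sum_le_sum fun i hi => Finset.sum_le_sum (h1 i hi)
  have h4 : ∑ i ∈ Finset.range n, ∑ j ∈ Finset.range n,
      (2 * (y i j (b i) : ℤ) + 2 * (y j i (b j) : ℤ) - 2) =
      4 * ((∑ i ∈ Finset.range n, load W n d i (b i) : ℕ) : ℤ) - 2 * n ^ 2 := by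
    have h5 : ∑ i ∈ Finset.range n, ∑ j ∈ Finset.range n, (y i j (b i) : ℤ) =
      ((∑ i ∈ Finset.range n, load W n d i (b i) : ℕ) : ℤ) := by
      push_cast
      simp only [load, Nat.cast_sum]
      rfl
    simp only [Finset.sum_sub_distrib, Finset.sum_add_distrib, ← Finset.mul_sum]
    rw [Finset.sum_comm (f := fun i j => (y j i (b j) : ℤ)), h5]
    simp
    ring
  rw [h4] at h3
  simp only [Finset.sum_sub_distrib] at h3
  unfold potential
  have : (colourWelfare W n s : ℤ) ≤ ((∑ i ∈ Finset.range n, load W n d i (b i) : ℕ) : ℤ) := by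
    exact_mod_cast hload
  linarith

include hW in
/-- The play yields a nearly optimal fractional colouring. -/
theorem welfare_le_overlap (hM : ∀ i < n, ∀ j < n, ∀ c < L, W i j c ≤ M) (hL : 0 < L)
    (T : ℕ) (hT : T = L * (M * M)) (s : ℕ → ℕ) (hs : ∀ i < n, s i < L) :
    T * colourWelfare W n s ≤ (∑ i ∈ Finset.range n, ∑ j ∈ Finset.range n,
      overlap W L (counts W n L T) i j) + T * n ^ 2 := by
  have h1 : ∀ r : ℕ, r * (4 * (colourWelfare W n s : ℤ) - 2 * n ^ 2) ≤
      potential W n L (counts W n L r) := by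
    intro r
    induction r with
    | zero => simp [potential, counts, count_nil, smoothMin, huber]
    | succ r ih =>
      have := potential_counts_succ hW hL r s hs
      push_cast
      linarith
  have h2 : potential W n L (counts W n L T) ≤ 4 * ((∑ i ∈ Finset.range n, ∑ j ∈ Finset.range n,
      overlap W L (counts W n L T) i j : ℕ) : ℤ) + n ^ 2 * T := by
    have h3 : ∀ i ∈ Finset.range n, ∀ j ∈ Finset.range n, ∑ c ∈ Finset.range L,
        smoothMin (W i j c) (count (counts W n L T) i c) (count (counts W n L T) j c) ≤
        4 * (overlap W L (counts W n L T) i j : ℤ) + T := by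
      intro i hi j hj
      have h4 : ∀ c ∈ Finset.range L,
          smoothMin (W i j c) (count (counts W n L T) i c) (count (counts W n L T) j c) ≤
          4 * ((W i j c * min (count (counts W n L T) i c) (count (counts W n L T) j c) : ℕ) : ℤ) +
            M * M := by
        intro c hc
        have h5 := hM i (by simpa using hi) j (by simpa using hj) c (by simpa using hc)
        have h6 := smoothMin_le (W i j c) (count (counts W n L T) i c) (count (counts W n L T) j c)
        have h7 : ((W i j c : ℕ) : ℤ) ^ 2 ≤ M * M := by
          rw [sq]; exact_mod_cast Nat.mul_le_mul h5 h5
        linarith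
      refine (Finset.sum_le_sum h4).trans (le_of_eq ?_)
      rw [Finset.sum_add_distrib, ← Finset.mul_sum, overlap]
      push_cast
      rw [hT]
      simp
    refine (Finset.sum_le_sum fun i hi => Finset.sum_le_sum (h3 i hi)).trans (le_of_eq ?_)
    simp only [Finset.sum_add_distrib, ← Finset.mul_sum]
    simp
    ring
  have h3 := (h1 T).trans h2
  have h4 : (T : ℤ) * colourWelfare W n s ≤ ((∑ i ∈ Finset.range n, ∑ j ∈ Finset.range n,
      overlap W L (counts W n L T) i j : ℕ) : ℤ) + T * n ^ 2 := by
    have : (0 : ℤ) ≤ T * n ^ 2 := by positivity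
    linarith
  exact_mod_cast h4

theorem sum_count_counts (hL : 0 < L) (r : ℕ) {i : ℕ} (hi : i < n) :
    ∑ c ∈ Finset.range L, count (counts W n L r) i c = r := by
  induction r with
  | zero => simp [counts, count_nil]
  | succ r ih =>
    rw [Finset.sum_congr rfl fun c hc => count_counts_succ W r hi (by simpa using hc),
      Finset.sum_add_distrib, ih, Finset.sum_ite_eq', if_pos]
    simpa using argmaxBelow_lt _ hL

end Fractional

/-! ### Rounding a fractional colouring -/

section Rounding

variable {W : ℕ → ℕ → ℕ → ℕ} {n L T : ℕ} {d : Datum}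

/-- The contribution of the pair `i, j` to the estimate. -/
def pairEstimate (W : ℕ → ℕ → ℕ → ℕ) (L T : ℕ) (d a : Datum) (i j : ℕ) : ℕ :=
  if assigned a i = 0 then
    if assigned a j = 0 then overlap W L d i j * (2 * T + common L d i j) else 0
  else if assigned a i = assigned a j then 4 * (T * T) * W i j (assigned a i - 1) else 0

theorem estimate_eq (a : Datum) : estimate W n L T d a =
    ∑ i ∈ Finset.range n, ∑ j ∈ Finset.range n, pairEstimate W L T d a i j := rfl

theorem sum_range_ite_lt {m T : ℕ} (h : m ≤ T) (x : ℤ) :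
    ∑ t ∈ Finset.range T, (if t < m then x else 0) = m * x := by
  rw [← Finset.sum_filter]
  have : (Finset.range T).filter (· < m) = Finset.range m := by
    ext t; simp; omega
  simp [this]

/-- On average over all colours and thresholds, the estimate for a pair does not decrease: a pair
without colours is coloured at once with weight `min`, and split or coloured with weight `max`. -/
theorem sum_pairEstimate_sub_nonneg (hd : ∀ i < n, ∑ c ∈ Finset.range L, count d i c = T)
    (a : Datum) {i j : ℕ} (hi : i < n) (hj : j < n) :
    0 ≤ ∑ c ∈ Finset.range L, ∑ t ∈ Finset.range T,
      ((pairEstimate W L T d (extend n d a c t) i j : ℤ) - pairEstimate W L T d a i j) := by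
  by_cases h : assigned a i = 0 ∧ assigned a j = 0
  · obtain ⟨hai, haj⟩ := h
    set β : ℤ := ((overlap W L d i j * (2 * T + common L d i j) : ℕ) : ℤ) with hβ
    have hβ0 : 0 ≤ β := by positivity
    have hle : ∀ k < n, ∀ c ∈ Finset.range L, count d k c ≤ T := fun k hk c hc =>
      (Finset.single_le_sum (f := fun c => count d k c) (fun _ _ => Nat.zero_le _) hc).trans
        (hd k hk).le
    have h1 : ∀ c ∈ Finset.range L, ∀ t ∈ Finset.range T,
        (if t < min (count d i c) (count d j c) then 4 * ((T : ℤ) * T) * W i j c else 0) -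
          (if t < max (count d i c) (count d j c) then β else 0) ≤
        (pairEstimate W L T d (extend n d a c t) i j : ℤ) - pairEstimate W L T d a i j := by
      intro c _ t _
      simp only [pairEstimate, assigned_extend _ _ _ _ hi, assigned_extend _ _ _ _ hj, hai, haj,
        if_true, lt_min_iff, lt_max_iff]
      by_cases h1 : t < count d i c <;> by_cases h2 : t < count d j c <;> simp [h1, h2, hβ]
    refine le_trans ?_ (Finset.sum_le_sum fun c hc => Finset.sum_le_sum (h1 c hc))
    have h2 : ∀ c ∈ Finset.range L, ∑ t ∈ Finset.range T,
        ((if t < min (count d i c) (count d j c) then 4 * ((T : ℤ) * T) * W i j c else 0) -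
          (if t < max (count d i c) (count d j c) then β else 0)) =
        4 * ((T : ℤ) * T) * ((W i j c * min (count d i c) (count d j c) : ℕ) : ℤ) -
          (count d i c + count d j c - (min (count d i c) (count d j c) : ℕ) : ℤ) * β := by
      intro c hc
      have h3 := hle i hi c hc
      have h4 := hle j hj c hc
      rw [Finset.sum_sub_distrib, sum_range_ite_lt (by omega), sum_range_ite_lt (by omega)]
      have : ((max (count d i c) (count d j c) : ℕ) : ℤ) =
        count d i c + count d j c - (min (count d i c) (count d j c) : ℕ) := by omega
      rw [this]
      push_cast
      ring
    rw [Finset.sum_congr rfl h2, Finset.sum_sub_distrib, ← Finset.mul_sum, ← Finset.sum_mul,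
      Finset.sum_sub_distrib, Finset.sum_add_distrib]
    simp only [← Nat.cast_sum]
    rw [hd i hi, hd j hj, ← overlap, ← common, hβ]
    have : 4 * ((T : ℤ) * T) * (overlap W L d i j : ℕ) - ((T : ℤ) + T - (common L d i j : ℕ)) *
        ((overlap W L d i j * (2 * T + common L d i j) : ℕ) : ℤ) =
        overlap W L d i j * (common L d i j : ℤ) ^ 2 := by
      push_cast; ring
    rw [this]
    positivity
  · refine Finset.sum_nonneg fun c _ => Finset.sum_nonneg fun t _ => ?_
    have : pairEstimate W L T d a i j ≤ pairEstimate W L T d (extend n d a c t) i j := by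
      simp only [pairEstimate, assigned_extend _ _ _ _ hi, assigned_extend _ _ _ _ hj]
      by_cases h1 : assigned a i = 0
      · have h2 : assigned a j ≠ 0 := fun h2 => h ⟨h1, h2⟩
        simp [h1, h2]
      · by_cases h2 : assigned a j = 0
        · simp [h1, h2]
        · simp [h1, h2]
    omega

theorem pairEstimate_congr {a a' : Datum} {i j : ℕ} (hi : assigned a i = assigned a' i)
    (hj : assigned a j = assigned a' j) :
    pairEstimate W L T d a i j = pairEstimate W L T d a' i j := by
  simp only [pairEstimate, hi, hj]

theorem estimate_congr {a a' : Datum} (h : ∀ i < n, assigned a i = assigned a' i) :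
    estimate W n L T d a = estimate W n L T d a' :=
  Finset.sum_congr rfl fun i hi => Finset.sum_congr rfl fun j hj =>
    pairEstimate_congr (h i (by simpa using hi)) (h j (by simpa using hj))

theorem sum_comm_pairs {ι : Type*} (A B C D : Finset ι) (F : ι → ι → ι → ι → ℤ) :
    ∑ a ∈ A, ∑ b ∈ B, ∑ c ∈ C, ∑ d ∈ D, F a b c d =
      ∑ c ∈ C, ∑ d ∈ D, ∑ a ∈ A, ∑ b ∈ B, F a b c d := by
  rw [← Finset.sum_product' (f := fun a b => ∑ c ∈ C, ∑ d ∈ D, F a b c d), Finset.sum_comm]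
  refine Finset.sum_congr rfl fun c _ => ?_
  rw [Finset.sum_comm]
  refine Finset.sum_congr rfl fun d _ => ?_
  rw [Finset.sum_product]

/-- Some extension colours a further player without decreasing the estimate. -/
theorem exists_extend (hd : ∀ i < n, ∑ c ∈ Finset.range L, count d i c = T) (hT : 0 < T)
    {a : Datum} (ha : ∃ i < n, assigned a i = 0) :
    ∃ c < L, ∃ t < T, estimate W n L T d a ≤ estimate W n L T d (extend n d a c t) ∧
      ∃ i < n, assigned a i = 0 ∧ t < count d i c := by
  by_contra! hcon
  obtain ⟨i, hi, hai⟩ := ha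
  obtain ⟨c, hc, hic⟩ : ∃ c ∈ Finset.range L, 0 < count d i c := by
    by_contra! h0
    have := hd i hi
    rw [Finset.sum_eq_zero fun c hc => Nat.le_zero.1 (h0 c hc)] at this
    omega
  have h1 : 0 ≤ ∑ c ∈ Finset.range L, ∑ t ∈ Finset.range T,
      ((estimate W n L T d (extend n d a c t) : ℤ) - estimate W n L T d a) := by
    have : ∀ c t, ((estimate W n L T d (extend n d a c t) : ℤ) - estimate W n L T d a) =
        ∑ i ∈ Finset.range n, ∑ j ∈ Finset.range n,
          ((pairEstimate W L T d (extend n d a c t) i j : ℤ) - pairEstimate W L T d a i j) := by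
      intro c t
      simp only [estimate_eq, Finset.sum_sub_distrib]
      push_cast
      rfl
    simp only [this]
    have h2 : ∑ c ∈ Finset.range L, ∑ t ∈ Finset.range T, ∑ i ∈ Finset.range n,
        ∑ j ∈ Finset.range n,
          ((pairEstimate W L T d (extend n d a c t) i j : ℤ) - pairEstimate W L T d a i j) =
        ∑ i ∈ Finset.range n, ∑ j ∈ Finset.range n, ∑ c ∈ Finset.range L, ∑ t ∈ Finset.range T,
          ((pairEstimate W L T d (extend n d a c t) i j : ℤ) - pairEstimate W L T d a i j) :=
      sum_comm_pairs _ _ _ _ _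
    rw [h2]
    exact Finset.sum_nonneg fun i hi => Finset.sum_nonneg fun j hj =>
      sum_pairEstimate_sub_nonneg hd a (by simpa using hi) (by simpa using hj)
  have h2 : ∀ c ∈ Finset.range L, ∀ t ∈ Finset.range T,
      ((estimate W n L T d (extend n d a c t) : ℤ) - estimate W n L T d a) ≤ 0 := by
    intro c hc t ht
    rcases le_or_gt (estimate W n L T d a) (estimate W n L T d (extend n d a c t)) with h | h
    · have h3 := hcon c (by simpa using hc) t (by simpa using ht) h
      have : estimate W n L T d (extend n d a c t) = estimate W n L T d a := by
        refine estimate_congr fun i hi => ?_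
        rw [assigned_extend _ _ _ _ hi]
        split_ifs with h4 h5
        · exact absurd h5 (by have := h3 i hi h4; omega)
        · exact h4.symm
        · rfl
      omega
    · omega
  have h3 : ∑ c ∈ Finset.range L, ∑ t ∈ Finset.range T,
      ((estimate W n L T d (extend n d a c t) : ℤ) - estimate W n L T d a) < 0 := by
    refine Finset.sum_neg' (fun c hc => Finset.sum_nonpos (h2 c hc)) ⟨c, hc, ?_⟩
    refine Finset.sum_neg' (h2 c hc) ⟨0, by simpa using hT, ?_⟩
    by_contra! h
    have := hcon c (by simpa using hc) 0 hT (by omega) i hi hai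
    omega
  omega

/-- The number of players with a colour. -/
def numAssigned (n : ℕ) (a : Datum) : ℕ :=
  ∑ i ∈ Finset.range n, if assigned a i = 0 then 0 else 1

theorem numAssigned_le (n : ℕ) (a : Datum) : numAssigned n a ≤ n := by
  have := Finset.sum_le_card_nsmul (Finset.range n) (fun i => if assigned a i = 0 then 0 else 1) 1
    (fun i _ => by split_ifs <;> simp)
  simpa [numAssigned] using this

theorem numAssigned_lt_extend {a : Datum} {c t i : ℕ} (hi : i < n) (hai : assigned a i = 0)
    (hc : t < count d i c) : numAssigned n a < numAssigned n (extend n d a c t) := by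
  refine Finset.sum_lt_sum (fun j hj => ?_) ⟨i, by simpa using hi, ?_⟩
  · rw [assigned_extend _ _ _ _ (by simpa using hj)]
    split_ifs <;> simp_all
  · rw [assigned_extend _ _ _ _ hi]
    simp [hai, hc]

theorem score_eq (a : Datum) :
    score W n L T d a = (n + 1) * estimate W n L T d a + numAssigned n a := rfl

theorem score_extend_le {a : Datum} {c t : ℕ} (hc : c < L) (ht : t < T) :
    score W n L T d (extend n d a c t) ≤ score W n L T d (assignStep W n L T d a) :=
  (le_argmaxBelow (fun t => score W n L T d (extend n d a c t)) ht).trans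
    (le_argmaxBelow (fun c => score W n L T d (extend n d a c (bestThreshold W n L T d a c))) hc)

theorem assignStep_spec (hd : ∀ i < n, ∑ c ∈ Finset.range L, count d i c = T) (hT : 0 < T)
    (a : Datum) : estimate W n L T d a ≤ estimate W n L T d (assignStep W n L T d a) ∧
      (numAssigned n a = n ∨ numAssigned n a < numAssigned n (assignStep W n L T d a)) ∧
      numAssigned n a ≤ numAssigned n (assignStep W n L T d a) := by
  by_cases ha : ∃ i < n, assigned a i = 0
  · obtain ⟨c, hc, t, ht, hest, i, hi, hai, hit⟩ := exists_extend (W := W) hd hT ha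
    have h1 := numAssigned_lt_extend hi hai hit
    have h2 := score_extend_le (W := W) (n := n) (d := d) (a := a) hc ht
    rw [score_eq, score_eq] at h2
    have h3 := Nat.mul_le_mul_left (n + 1) hest
    have h4 := numAssigned_le n (assignStep W n L T d a)
    have h5 : estimate W n L T d a ≤ estimate W n L T d (assignStep W n L T d a) := by
      by_contra! h
      have := Nat.mul_le_mul_left (n + 1) (Nat.succ_le_of_lt h)
      rw [Nat.mul_succ] at this
      omega
    have h6 : numAssigned n a < numAssigned n (assignStep W n L T d a) := by
      by_cases hh : ∃ i < n, assigned a i = 0 ∧ bestThreshold W n L T d a (bestColour W n L T d a) <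
          count d i (bestColour W n L T d a)
      · obtain ⟨i, hi, hai, hit⟩ := hh
        exact numAssigned_lt_extend hi hai hit
      · have h7 : ∀ i < n, assigned (assignStep W n L T d a) i = assigned a i := by
          intro i hi
          rw [assignStep, assigned_extend _ _ _ _ hi]
          split_ifs with h8 h9
          · exact absurd ⟨i, hi, h8, h9⟩ hh
          · exact h8.symm
          · rfl
        have h8 := estimate_congr (W := W) (L := L) (T := T) (d := d) h7
        have h9 : numAssigned n (assignStep W n L T d a) = numAssigned n a :=
          Finset.sum_congr rfl fun i hi => by rw [h7 i (by simpa using hi)]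
        rw [h8, h9] at h2
        omega
    exact ⟨h5, .inr h6, h6.le⟩
  · push Not at ha
    have h7 : ∀ i < n, assigned (assignStep W n L T d a) i = assigned a i := by
      intro i hi
      rw [assignStep, assigned_extend _ _ _ _ hi, if_neg (ha i hi)]
    have h9 : numAssigned n (assignStep W n L T d a) = numAssigned n a :=
      Finset.sum_congr rfl fun i hi => by rw [h7 i (by simpa using hi)]
    refine ⟨(estimate_congr h7).ge, .inl ?_, h9.ge⟩
    rw [numAssigned, Finset.sum_congr rfl fun i hi => if_neg (ha i (by simpa using hi))]
    simp

/-- The rounded colouring colours all players and keeps the initial estimate. -/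
theorem assignment_spec (hd : ∀ i < n, ∑ c ∈ Finset.range L, count d i c = T) (hT : 0 < T) :
    (∀ i < n, assigned (assignment W n L T d n) i ≠ 0) ∧
      ∑ i ∈ Finset.range n, ∑ j ∈ Finset.range n,
        overlap W L d i j * (2 * T + common L d i j) ≤
      4 * (T * T) * ∑ i ∈ Finset.range n, colourPayoff W n (assignment W n L T d n) i := by
  have h1 : ∀ r, estimate W n L T d .nil ≤ estimate W n L T d (assignment W n L T d r) ∧
      min n r ≤ numAssigned n (assignment W n L T d r) := by
    intro r
    induction r with
    | zero => exact ⟨le_rfl, by simp⟩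
    | succ r ih =>
      obtain ⟨h1, h2, h3⟩ := assignStep_spec (W := W) hd hT (assignment W n L T d r)
      exact ⟨ih.1.trans h1, by rw [assignment]; omega⟩
  obtain ⟨h2, h3⟩ := h1 n
  set a := assignment W n L T d n
  have h4 : ∀ i < n, assigned a i ≠ 0 := by
    intro i hi h0
    have : numAssigned n a < n := by
      have := Finset.sum_lt_sum (s := Finset.range n)
        (f := fun i => if assigned a i = 0 then 0 else 1) (g := fun _ => 1)
        (fun j _ => by split_ifs <;> simp) ⟨i, by simpa using hi, by simp [h0]⟩
      simpa [numAssigned] using this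
    omega
  refine ⟨h4, ?_⟩
  have h5 : estimate W n L T d .nil = ∑ i ∈ Finset.range n, ∑ j ∈ Finset.range n,
      overlap W L d i j * (2 * T + common L d i j) := by
    simp [estimate, assigned_nil]
  have h6 : estimate W n L T d a = 4 * (T * T) * ∑ i ∈ Finset.range n, colourPayoff W n a i := by
    rw [Finset.mul_sum, estimate]
    refine Finset.sum_congr rfl fun i hi => ?_
    rw [colourPayoff, Finset.mul_sum]
    refine Finset.sum_congr rfl fun j _ => ?_
    rw [if_neg (h4 i (by simpa using hi)), mul_ite, mul_zero]
  rw [← h5, ← h6]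
  exact h2

/-- The colouring reaches half of the optimum of the original game. The rounding of the weights
costs at most `n ^ 2`, and so does the finite length of the play. Both are compensated by the
common choices: pairs whose members hardly ever choose the same colour contribute little. -/
theorem le_two_mul_sum_colourPayoff {M : ℕ} (hn : 0 < n) (hL : 0 < L)
    (hM : M = 16 * (n * n * (n * n))) (hT : T = L * (M * M))
    (hW : ∀ i < n, ∀ j < n, ∀ c, W i j c = W j i c)
    (hWM : ∀ i < n, ∀ j < n, ∀ c < L, W i j c ≤ M) (s : ℕ → ℕ) (hs : ∀ i < n, s i < L) {Q : ℚ}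
    (hMQ : M ≤ Q) (hQ : Q ≤ colourWelfare W n s + n ^ 2) :
    Q ≤ 2 * ((∑ i ∈ Finset.range n,
      colourPayoff W n (assignment W n L T (counts W n L T) n) i : ℕ) : ℚ) := by
  set d := counts W n L T
  have hMpos : 0 < M := by rw [hM]; positivity
  have hTpos : 0 < T := by rw [hT]; positivity
  have h1 := (assignment_spec (W := W) (d := d) (fun i hi => sum_count_counts hL T hi) hTpos).2
  have h2 := welfare_le_overlap hW hWM hL T hT s hs
  generalize (∑ i ∈ Finset.range n, colourPayoff W n (assignment W n L T d n) i) = P at *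
  change (∑ i ∈ Finset.range n, ∑ j ∈ Finset.range n,
    overlap W L d i j * (2 * T + common L d i j)) ≤ _ at h1
  have h3 : ∀ i < n, ∀ j < n, overlap W L d i j ≤ M * common L d i j := by
    intro i hi j hj
    rw [overlap, common, Finset.mul_sum]
    exact Finset.sum_le_sum fun c hc =>
      Nat.mul_le_mul_right _ (hWM i hi j hj c (by simpa using hc))
  -- The common choices contribute at least the squares of the overlaps.
  have h4 : ∑ p ∈ Finset.range n ×ˢ Finset.range n,
      (2 * (T : ℚ) * M * (overlap W L d p.1 p.2 : ℚ) + (overlap W L d p.1 p.2 : ℚ) ^ 2) ≤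
      (M : ℚ) * (4 * (T * T) * P) := by
    have h5 : (∑ p ∈ Finset.range n ×ˢ Finset.range n,
        ((overlap W L d p.1 p.2 * (2 * T + common L d p.1 p.2) : ℕ) : ℚ)) ≤ 4 * (T * T) * P := by
      rw [← Finset.sum_product'] at h1
      exact_mod_cast h1
    refine le_trans ?_ (mul_le_mul_of_nonneg_left h5 (by positivity))
    rw [Finset.mul_sum]
    refine Finset.sum_le_sum fun p hp => ?_
    simp only [Finset.mem_product, Finset.mem_range] at hp
    have h6 : (overlap W L d p.1 p.2 : ℚ) ≤ M * common L d p.1 p.2 := by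
      exact_mod_cast h3 _ hp.1 _ hp.2
    have h7 : (0 : ℚ) ≤ overlap W L d p.1 p.2 := by positivity
    push_cast
    nlinarith
  set E : ℚ := ∑ p ∈ Finset.range n ×ˢ Finset.range n, (overlap W L d p.1 p.2 : ℚ) with hE
  have h5 : E ^ 2 ≤ n ^ 2 * ∑ p ∈ Finset.range n ×ˢ Finset.range n,
      (overlap W L d p.1 p.2 : ℚ) ^ 2 := by
    have := sq_sum_le_card_mul_sum_sq (s := Finset.range n ×ˢ Finset.range n)
      (f := fun p => (overlap W L d p.1 p.2 : ℚ))
    simpa [← sq] using this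
  rw [Finset.sum_add_distrib, ← Finset.mul_sum, ← hE] at h4
  have h6 : (T : ℚ) * colourWelfare W n s ≤ E + T * n ^ 2 := by
    rw [← Finset.sum_product'] at h2
    rw [hE]
    exact_mod_cast h2
  have hT' : (0 : ℚ) < T := by exact_mod_cast hTpos
  have hM' : (0 : ℚ) < M := by exact_mod_cast hMpos
  have hn' : (1 : ℚ) ≤ n := by exact_mod_cast hn
  set x : ℚ := E / T with hx
  have hEx : E = x * T := by rw [hx]; field_simp
  have h7 : Q - 2 * n ^ 2 ≤ x := by
    have : (T : ℚ) * (Q - 2 * n ^ 2) ≤ T * x := by nlinarith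
    exact le_of_mul_le_mul_left this hT'
  have hMn : (M : ℚ) = 16 * (n ^ 2) ^ 2 := by rw [hM]; push_cast; ring
  have h8 : (2 * M * x * n ^ 2 + x ^ 2) ≤ n ^ 2 * M * (4 * P) := by
    have h9 : (T : ℚ) ^ 2 * (2 * M * x * n ^ 2 + x ^ 2) ≤ T ^ 2 * (n ^ 2 * M * (4 * P)) := by
      have := mul_le_mul_of_nonneg_left h4 (by positivity : (0 : ℚ) ≤ n ^ 2)
      rw [hEx] at h5 this
      nlinarith
    exact le_of_mul_le_mul_left h9 (by positivity)
  set N : ℚ := (n : ℚ) ^ 2 with hN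
  have hN1 : 1 ≤ N := by rw [hN]; nlinarith
  have h10 : M / 2 ≤ x := by nlinarith
  have h11 : (M : ℚ) * N * 4 * N ≤ x ^ 2 := by nlinarith
  have h12 : M * N * (2 * Q) ≤ M * N * (4 * P) := by nlinarith [mul_pos hM' (by linarith : 0 < N)]
  have := le_of_mul_le_mul_left h12 (by positivity)
  linarith

end Rounding

/-! ### Selecting the players of highest payoff -/

section Ranking

theorem rankBelow_lt {n : ℕ} (f : ℕ → ℕ) {i j : ℕ} (hj : j < n)
    (h : f i < f j ∨ f i = f j ∧ j < i) : rankBelow n f j < rankBelow n f i := by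
  refine Finset.sum_lt_sum (fun l _ => ?_) ⟨j, by simpa using hj, ?_⟩
  · split_ifs <;> omega
  · simp only [lt_irrefl, if_false, if_true]
    split_ifs <;> omega

theorem rankBelow_inj {n : ℕ} (f : ℕ → ℕ) {i j : ℕ} (hi : i < n) (hj : j < n)
    (h : rankBelow n f i = rankBelow n f j) : i = j := by
  by_contra hne
  rcases lt_trichotomy (f i) (f j) with h1 | h1 | h1
  · exact (rankBelow_lt f hj (.inl h1)).ne' h
  · rcases lt_or_gt_of_ne hne with h2 | h2
    · exact (rankBelow_lt f hi (.inr ⟨h1.symm, h2⟩)).ne h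
    · exact (rankBelow_lt f hj (.inr ⟨h1, h2⟩)).ne' h
  · exact (rankBelow_lt f hi (.inl h1)).ne h

theorem rankBelow_lt_self {n : ℕ} (f : ℕ → ℕ) {i : ℕ} (hi : i < n) : rankBelow n f i < n := by
  have := Finset.sum_lt_sum (s := Finset.range n) (g := fun _ => 1)
    (f := fun j => if f i < f j then 1 else if f i = f j then if j < i then 1 else 0 else 0)
    (fun l _ => by split_ifs <;> omega) ⟨i, by simpa using hi, by simp⟩
  simpa [rankBelow] using this

theorem card_rankBelow_lt {n k : ℕ} (f : ℕ → ℕ) (hk : k ≤ n) :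
    ((Finset.univ : Finset (Fin n)).filter fun i : Fin n => rankBelow n f i < k).card = k := by
  let g : Fin n → Fin n := fun i => ⟨rankBelow n f i, rankBelow_lt_self f i.2⟩
  have hg : Function.Bijective g := Finite.injective_iff_bijective.1 fun i j h =>
    Fin.ext (rankBelow_inj f i.2 j.2 (by simpa [g] using h))
  have h1 : ((Finset.univ : Finset (Fin n)).filter fun i : Fin n => rankBelow n f i < k).card =
      ((Finset.univ : Finset (Fin n)).filter fun i : Fin n => (i : ℕ) < k).card :=
    Finset.card_bij (fun i _ => g i) (by simp [g]) (fun _ _ _ _ h => hg.1 h) (by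
      intro b hb
      obtain ⟨i, rfl⟩ := hg.2 b
      exact ⟨i, by simpa [g] using hb, rfl⟩)
  rw [h1, Fin.card_filter_val_lt]
  omega

theorem mul_sum_le_mul_sum_rankBelow {n k : ℕ} (f : ℕ → ℕ) (hk : k ≤ n) :
    k * ∑ i : Fin n, f i ≤
      n * ∑ i ∈ Finset.univ.filter (fun i : Fin n => rankBelow n f i < k), f i := by
  set K := (Finset.univ : Finset (Fin n)).filter fun i : Fin n => rankBelow n f i < k with hK
  have hcard : K.card = k := card_rankBelow_lt f hk
  have h1 : K.card * ∑ j ∈ Kᶜ, f j ≤ Kᶜ.card * ∑ i ∈ K, f i := by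
    rw [← smul_eq_mul, ← Finset.sum_const, ← smul_eq_mul, ← Finset.sum_const, Finset.sum_comm]
    refine Finset.sum_le_sum fun j hj => Finset.sum_le_sum fun i hi => ?_
    simp only [hK, Finset.mem_compl, Finset.mem_filter, Finset.mem_univ, true_and] at hi hj
    by_contra! h
    have := rankBelow_lt (n := n) f j.2 (.inl h)
    omega
  rw [Finset.card_compl, Fintype.card_fin, hcard] at h1
  rw [← Finset.sum_add_sum_compl K, mul_add]
  have : n * ∑ i ∈ K, f i = k * ∑ i ∈ K, f i + (n - k) * ∑ i ∈ K, f i := by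
    rw [← add_mul]; congr 1; omega
  omega

end Ranking

/-! ### Reading the encoded game -/

theorem sameName_ofNat (a b : ℕ) : sameName (ofNat a) (ofNat b) = if a = b then 1 else 0 := by
  split_ifs with h
  · simp [sameName, h]
  · unfold sameName
    split_ifs with hlen
    · rw [Nat.sub_eq_zero_iff_le, Nat.one_le_iff_ne_zero]
      intro h0
      rw [Finset.sum_eq_zero_iff] at h0
      refine h ?_
      rw [← value_ofNat a, ← value_ofNat b, value, value, ← hlen]
      refine Finset.sum_congr rfl fun l hl => ?_
      have := h0 l hl
      rw [show (ofNat a).bit l = (ofNat b).bit l by by_contra h1; simp [h1] at this]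
    · rfl

theorem sum_range_getD {β : Type*} [AddCommMonoid β] (l : List ℕ) (f : ℕ → β) :
    ∑ u ∈ Finset.range l.length, f (l.getD u 0) = (l.map f).sum := by
  induction l with
  | nil => simp
  | cons a l ih =>
    rw [List.length_cons, Finset.sum_range_succ', List.map_cons, List.sum_cons, ← ih, add_comm]
    simp

theorem sum_range_sort_getD {β : Type*} [AddCommMonoid β] (S : Finset ℕ) (f : ℕ → β) :
    ∑ u ∈ Finset.range S.card, f ((S.sort (· ≤ ·)).getD u 0) = ∑ a ∈ S, f a := by
  rw [← Finset.length_sort (· ≤ ·), sum_range_getD, ← List.sum_toFinset _ (Finset.sort_nodup _ _),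
    Finset.sort_toFinset]

theorem nth_ofList_map {l : List ℕ} {u : ℕ} (f : ℕ → Datum) (h : u < l.length) :
    (ofList (l.map f)).nth u = f (l.getD u 0) := by
  simp [nth_ofList, List.getD_eq_getElem?_getD, h]

namespace CoordGame

variable {n : ℕ} (G : CoordGame n) (k : ℕ)

/-- The input of the algorithm. -/
noncomputable def input : Datum := .node G.encode (ofNat k)

open Classical in
/-- The payoff that player `i` obtains from player `j`, where the individual preference is
considered as a payoff obtained from oneself. -/
noncomputable def pairPay (i j : Fin n) (a b : ℕ) : ℚ :=
  (if i = j then G.pref i a else 0) + if G.graph.Adj i j then G.edgePay i j a b else 0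

theorem payoff_eq (s : G.Profile) (i : Fin n) :
    G.payoff s i = ∑ j, G.pairPay i j (s i) (s j) := by
  simp [payoff, pairPay, Finset.sum_add_distrib, Finset.sum_filter]

theorem welfare_eq (s : G.Profile) : G.welfare s = ∑ i, ∑ j, G.pairPay i j (s i) (s j) := by
  simp only [welfare, payoff_eq]

theorem pairPay_nonneg {i j : Fin n} {a b : ℕ} (ha : a ∈ G.S i) (hb : b ∈ G.S j) :
    0 ≤ G.pairPay i j a b := by
  unfold pairPay
  have h1 := G.pref_nonneg i a ha
  have h2 := G.edgePay_nonneg i j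
  split_ifs with h3 h4 h4
  · exact add_nonneg h1 (h2 h4 a ha b hb)
  · simpa using h1
  · simpa using h2 h4 a ha b hb
  · simp

theorem pairPay_symm {i j : Fin n} {a b : ℕ} (ha : a ∈ G.S i) (hb : b ∈ G.S j)
    (h : i = j → a = b) : G.pairPay i j a b = G.pairPay j i b a := by
  rcases eq_or_ne i j with rfl | hne
  · rw [h rfl]
  · by_cases hadj : G.graph.Adj i j
    · simp [pairPay, hne, hne.symm, hadj, hadj.symm, G.edgePay_symm i j hadj a ha b hb]
    · simp [pairPay, hne, hne.symm, hadj, G.graph.adj_comm j i]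

theorem welfare_nonneg (s : G.Profile) : 0 ≤ G.welfare s := by
  rw [welfare_eq]
  exact Finset.sum_nonneg fun i _ => Finset.sum_nonneg fun j _ =>
    G.pairPay_nonneg (s i).2 (s j).2

theorem pairPay_le_welfare (s : G.Profile) (i j : Fin n) :
    G.pairPay i j (s i) (s j) ≤ G.welfare s := by
  rw [welfare_eq]
  refine (Finset.single_le_sum (f := fun j => G.pairPay i j (s i) (s j)) (fun j _ =>
    G.pairPay_nonneg (s i).2 (s j).2) (Finset.mem_univ j)).trans ?_
  exact Finset.single_le_sum (f := fun i => ∑ j, G.pairPay i j (s i) (s j)) (fun i _ =>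
    Finset.sum_nonneg fun j _ => G.pairPay_nonneg (s i).2 (s j).2) (Finset.mem_univ i)

theorem pairPay_le_optimum {opt : G.Profile} (h : G.IsSocialOptimum opt) {i j : Fin n} {a b : ℕ}
    (ha : a ∈ G.S i) (hb : b ∈ G.S j) : G.pairPay i j a b ≤ G.welfare opt := by
  classical
  rcases eq_or_ne i j with rfl | hne
  · refine le_trans ?_ (h (Function.update opt i ⟨a, ha⟩))
    refine le_trans (le_of_eq ?_) (G.pairPay_le_welfare _ i i)
    simp [pairPay]
  · refine le_trans ?_ (h (Function.update (Function.update opt i ⟨a, ha⟩) j ⟨b, hb⟩))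
    refine le_trans (le_of_eq ?_) (G.pairPay_le_welfare _ i j)
    simp [hne]

/-- The name of strategy number `u` of player `i`. -/
def nameAt (i : Fin n) (u : ℕ) : ℕ := ((G.S i).sort (· ≤ ·)).getD u 0

theorem nameAt_mem {i : Fin n} {u : ℕ} (h : u < (G.S i).card) : G.nameAt i u ∈ G.S i := by
  have h' : u < ((G.S i).sort (· ≤ ·)).length := by simpa using h
  rw [nameAt, List.getD_eq_getElem _ _ h', ← Finset.mem_sort (· ≤ ·)]
  exact List.getElem_mem h'

theorem exists_nameAt_eq {i : Fin n} {a : ℕ} (h : a ∈ G.S i) :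
    ∃ u < (G.S i).card, G.nameAt i u = a := by
  rw [← Finset.mem_sort (· ≤ ·)] at h
  obtain ⟨u, hu, rfl⟩ := List.getElem_of_mem h
  exact ⟨u, by simpa using hu, List.getD_eq_getElem _ _ hu⟩

theorem nameAt_inj {i : Fin n} {u v : ℕ} (hu : u < (G.S i).card) (hv : v < (G.S i).card)
    (h : G.nameAt i u = G.nameAt i v) : u = v := by
  have hu' : u < ((G.S i).sort (· ≤ ·)).length := by simpa using hu
  have hv' : v < ((G.S i).sort (· ≤ ·)).length := by simpa using hv
  rw [nameAt, nameAt, List.getD_eq_getElem _ _ hu', List.getD_eq_getElem _ _ hv'] at h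
  exact (List.Nodup.getElem_inj_iff (Finset.sort_nodup _ _)).1 h

theorem nth_players (i : Fin n) : (G.input k).left.left.nth i = G.encodePlayer i := by
  simp [input, encode, left, nth_ofList]

@[simp] theorem numPlayers_input : numPlayers (G.input k) = n := by
  simp [numPlayers, input, encode, left, len_ofList]

@[simp] theorem numStrats_input (i : Fin n) : numStrats (G.input k) i = (G.S i).card := by
  simp [numStrats, nth_players, encodePlayer, len_ofList]

theorem nth_encodePlayer {i : Fin n} {u : ℕ} (hu : u < (G.S i).card) :
    (G.encodePlayer i).nth u = .node (ofNat (G.nameAt i u)) (ofRat (G.pref i (G.nameAt i u))) := by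
  rw [encodePlayer, nth_ofList_map _ (by simpa using hu)]
  rfl

theorem stratName_input {i : Fin n} {u : ℕ} (hu : u < (G.S i).card) :
    stratName (G.input k) i u = ofNat (G.nameAt i u) := by
  rw [stratName, nth_players, nth_encodePlayer _ hu]; rfl

theorem exists_stratName_eq (i u : ℕ) : ∃ a, stratName (G.input k) i u = ofNat a := by
  by_cases hi : i < n
  · by_cases hu : u < (G.S ⟨i, hi⟩).card
    · exact ⟨_, G.stratName_input k (i := ⟨i, hi⟩) hu⟩
    · refine ⟨0, ?_⟩
      have := G.nth_players k ⟨i, hi⟩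
      dsimp only at this
      rw [stratName, this, encodePlayer, nth_ofList, List.getD_eq_default _ _ (by simpa using hu)]
      rfl
  · refine ⟨0, ?_⟩
    rw [stratName, input, encode, left, left, nth_ofList,
      List.getD_eq_default _ _ (by simpa using hi), nth_nil]
    rfl

open Classical in
/-- The encoding of `pairPay` that can be found in the input: pairs without an edge have none. -/
noncomputable def encodePairPay (i j : Fin n) (a b : ℕ) : Datum :=
  if i = j ∨ G.graph.Adj i j then ofRat (G.pairPay i j a b) else .nil

theorem entry_input {i j : Fin n} {u v : ℕ} (hu : u < (G.S i).card) (hv : v < (G.S j).card) :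
    entry (G.input k) i j u v = G.encodePairPay i j (G.nameAt i u) (G.nameAt j v) := by
  unfold entry encodePairPay
  rcases eq_or_ne i j with rfl | h
  · simp [nth_players, nth_encodePlayer _ hu, right, pairPay]
  · have h1 : ((G.input k).left.right.nth i).nth j = G.encodePair i j := by
      simp [input, encode, left, right, nth_ofList]
    rw [if_neg (by simpa [Fin.ext_iff] using h), h1]
    by_cases hadj : G.graph.Adj i j
    · rw [encodePair, if_pos hadj, right, nth_ofList_map _ (by simpa using hu),
        nth_ofList_map _ (by simpa using hv)]
      simp [hadj, h, pairPay, nameAt]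
    · simp [encodePair, hadj, h, right, nth_nil]

theorem ratLE_encodePairPay {i j : Fin n} {a b : ℕ} (ha : a ∈ G.S i) (hb : b ∈ G.S j) (m M : ℕ)
    {q : ℚ} (hq : 0 ≤ q) : ratLE m (G.encodePairPay i j a b) M (ofRat q) =
      if (m : ℚ) * G.pairPay i j a b ≤ M * q then 1 else 0 := by
  unfold encodePairPay
  split_ifs with h1 h2 h2
  · rw [ratLE_ofRat _ _ (G.pairPay_nonneg ha hb) hq, if_pos h2]
  · rw [ratLE_ofRat _ _ (G.pairPay_nonneg ha hb) hq, if_neg h2]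
  · simp [ratLE_eq, left, right, value, len]
  · push Not at h1
    refine absurd ?_ h2
    simp only [pairPay, h1.1, h1.2, if_false, add_zero, mul_zero]
    positivity

theorem numExceeding_eq_zero_iff (m M : ℕ) {q : ℚ} (hq : 0 ≤ q) :
    numExceeding (G.input k) m M (ofRat q) = 0 ↔
      ∀ i j, ∀ a ∈ G.S i, ∀ b ∈ G.S j, (m : ℚ) * G.pairPay i j a b ≤ M * q := by
  have h1 : ∀ i j : Fin n, ∀ u < (G.S i).card, ∀ v < (G.S j).card,
      (1 - ratLE m (entry (G.input k) i j u v) M (ofRat q) = 0 ↔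
        (m : ℚ) * G.pairPay i j (G.nameAt i u) (G.nameAt j v) ≤ M * q) := by
    intro i j u hu v hv
    rw [entry_input _ _ hu hv, ratLE_encodePairPay _ (G.nameAt_mem hu) (G.nameAt_mem hv) _ _ hq]
    split_ifs with h <;> simp [h]
  simp only [numExceeding, numPlayers_input, Finset.sum_range, Finset.sum_eq_zero_iff,
    Finset.mem_univ, forall_const]
  constructor
  · intro h i j a ha b hb
    obtain ⟨u, hu, rfl⟩ := G.exists_nameAt_eq ha
    obtain ⟨v, hv, rfl⟩ := G.exists_nameAt_eq hb
    have h2 := h i j ⟨u, by simpa using hu⟩ ⟨v, by simpa using hv⟩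
    exact (h1 i j u hu v hv).1 h2
  · intro h i j u v
    have hu : (u : ℕ) < (G.S i).card := by simpa using u.2
    have hv : (v : ℕ) < (G.S j).card := by simpa using v.2
    exact (h1 i j u hu v hv).2 (h i j _ (G.nameAt_mem hu) _ (G.nameAt_mem hv))

/-- `ω` is the largest payoff. -/
def IsMaxPay (ω : ℚ) : Prop :=
  (∀ i j, ∀ a ∈ G.S i, ∀ b ∈ G.S j, G.pairPay i j a b ≤ ω) ∧
    ∃ i j, ∃ a ∈ G.S i, ∃ b ∈ G.S j, G.pairPay i j a b = ω

variable {G} {ω : ℚ}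

theorem IsMaxPay.rounded_ofRat (hω : G.IsMaxPay ω) (hpos : 0 < ω) {q : ℚ} (hq : 0 ≤ q)
    (hqω : q ≤ ω) :
    rounded (G.input k) (ofRat q) = ⌊scale (G.input k) * q / ω⌋₊ := by
  unfold rounded
  set M := scale (G.input k)
  have hx : (0 : ℚ) ≤ M * q / ω := by positivity
  split_ifs with h0
  · have : q = 0 := by
      simp only [ofRat, left, len_ofNat_eq_zero, Int.natAbs_eq_zero, Rat.num_eq_zero] at h0
      exact h0
    simp [this]
  · have h1 : ∀ m, 1 - numExceeding (G.input k) (m + 1) M (ofRat q) =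
        if m < ⌊M * q / ω⌋₊ then 1 else 0 := by
      intro m
      have h2 : numExceeding (G.input k) (m + 1) M (ofRat q) = 0 ↔ m < ⌊M * q / ω⌋₊ := by
        rw [numExceeding_eq_zero_iff _ _ _ _ hq, ← Nat.succ_le_iff, Nat.le_floor_iff hx,
          le_div_iff₀ hpos]
        obtain ⟨hmax, i, j, a, ha, b, hb, hab⟩ := hω
        constructor
        · intro h
          rw [← hab]
          exact h i j a ha b hb
        · intro h i j a ha b hb
          exact (mul_le_mul_of_nonneg_left (hmax i j a ha b hb) (by positivity)).trans h
      split_ifs with h3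
      · rw [h2.2 h3]
      · have := mt h2.1 h3
        omega
    simp only [h1]
    rw [← Finset.sum_filter, Finset.sum_const, smul_eq_mul, mul_one]
    have : (Finset.range M).filter (· < ⌊M * q / ω⌋₊) = Finset.range ⌊M * q / ω⌋₊ := by
      ext m
      have : ⌊M * q / ω⌋₊ ≤ M := by
        refine Nat.floor_le_of_le ?_
        rw [div_le_iff₀ hpos]
        gcongr
      simp
      omega
    rw [this, Finset.card_range]

theorem IsMaxPay.rounded_encodePairPay (hω : G.IsMaxPay ω) (hpos : 0 < ω) {i j : Fin n} {a b : ℕ}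
    (ha : a ∈ G.S i) (hb : b ∈ G.S j) :
    rounded (G.input k) (G.encodePairPay i j a b) =
      ⌊scale (G.input k) * G.pairPay i j a b / ω⌋₊ := by
  unfold encodePairPay
  split_ifs with h
  · exact hω.rounded_ofRat k hpos (G.pairPay_nonneg ha hb) (hω.1 i j a ha b hb)
  · push Not at h
    simp [rounded, left, len, pairPay, h.1, h.2]

variable (G)

theorem exists_colourName_eq (c : ℕ) : ∃ α, colourName (G.input k) c = ofNat α :=
  G.exists_stratName_eq k _ _

variable {G}

theorem IsMaxPay.weight_input (hω : G.IsMaxPay ω) (hpos : 0 < ω) (i j : Fin n) {c α : ℕ}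
    (hc : colourName (G.input k) c = ofNat α) :
    weight (G.input k) i j c = if α ∈ G.S i ∧ α ∈ G.S j then
      ⌊scale (G.input k) * G.pairPay i j α α / ω⌋₊ else 0 := by
  have h1 : weight (G.input k) i j c = ∑ u ∈ Finset.range (G.S i).card,
      ∑ v ∈ Finset.range (G.S j).card,
        if G.nameAt i u = α ∧ G.nameAt j v = α then
          ⌊scale (G.input k) * G.pairPay i j α α / ω⌋₊ else 0 := by
    simp only [weight, numStrats_input]
    refine Finset.sum_congr rfl fun u hu => Finset.sum_congr rfl fun v hv => ?_
    simp only [Finset.mem_range] at hu hv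
    rw [stratName_input _ _ hu, stratName_input _ _ hv, hc, sameName_ofNat, sameName_ofNat,
      entry_input _ _ hu hv,
      hω.rounded_encodePairPay k hpos (G.nameAt_mem hu) (G.nameAt_mem hv)]
    by_cases h1 : G.nameAt i u = α <;> by_cases h2 : G.nameAt j v = α <;> simp [h1, h2]
  refine h1.trans ((sum_range_sort_getD (G.S i) fun x => ∑ v ∈ Finset.range (G.S j).card,
        if x = α ∧ G.nameAt j v = α then
          ⌊scale (G.input k) * G.pairPay i j α α / ω⌋₊ else 0).trans ?_)
  have h2 : ∀ x, (∑ v ∈ Finset.range (G.S j).card,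
        if x = α ∧ G.nameAt j v = α then ⌊scale (G.input k) * G.pairPay i j α α / ω⌋₊ else 0) =
      ∑ y ∈ G.S j, if x = α ∧ y = α then ⌊scale (G.input k) * G.pairPay i j α α / ω⌋₊ else 0 :=
    fun x => sum_range_sort_getD (G.S j) fun y =>
      if x = α ∧ y = α then ⌊scale (G.input k) * G.pairPay i j α α / ω⌋₊ else 0
  refine (Finset.sum_congr rfl fun x _ => h2 x).trans ?_
  simp only [ite_and, Finset.sum_ite_irrel, Finset.sum_const_zero, Finset.sum_ite_eq']

variable (G)

theorem numSlots_input : numSlots (G.input k) = ∑ i, (G.S i).card := by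
  simp [numSlots, Finset.sum_range]

theorem exists_colour {i : Fin n} {a : ℕ} (ha : a ∈ G.S i) :
    ∃ c < numColours (G.input k), colourName (G.input k) c = ofNat a := by
  obtain ⟨u, hu, rfl⟩ := G.exists_nameAt_eq ha
  have h1 : u < numSlots (G.input k) := by
    rw [numSlots_input]
    exact hu.trans_le (Finset.single_le_sum (f := fun i => (G.S i).card)
      (fun _ _ => Nat.zero_le _) (Finset.mem_univ i))
  refine ⟨u + numSlots (G.input k) * i, ?_, ?_⟩
  · have := Nat.mul_le_mul_left (numSlots (G.input k)) (Nat.succ_le_of_lt i.2)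
    rw [numColours, numPlayers_input, mul_comm n]
    rw [Nat.mul_succ] at this
    omega
  · rw [colourName, Nat.add_mul_div_left _ _ (by omega), Nat.div_eq_of_lt h1, zero_add,
      Nat.add_mul_mod_self_left, Nat.mod_eq_of_lt h1, stratName_input _ _ hu]

theorem selected_input (a : Datum) (i : ℕ) : 0 < selected (G.input k) a i ↔
    rankBelow n (colourPayoff (weight (G.input k)) n a) i < k := by
  have h1 : (G.input k).right = ofNat k := rfl
  rw [selected, digitsLE_eq, h1, sum_bit_mul (by omega), value_ofNat, numPlayers_input]
  simp only [ite_mul, zero_mul, Finset.sum_ite_eq', Finset.mem_range]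
  split_ifs <;> simp_all

/-- The strategy that the algorithm assigns to player `i` carries the name of the colour of `i`,
provided that the player has a strategy of this name. -/
theorem exists_strategy (a : Datum) (i : Fin n) : ∃ σ ∈ G.S i,
    stratName (G.input k) i (chosenStrat (G.input k) a i) = ofNat σ ∧
      ∀ α ∈ G.S i, colourName (G.input k) (assigned a i - 1) = ofNat α → σ = α := by
  obtain ⟨β, hβ⟩ := G.exists_colourName_eq k (assigned a i - 1)
  have h1 : chosenStrat (G.input k) a i =
      ∑ u ∈ Finset.range (G.S i).card, if G.nameAt i u = β then u else 0 := by
    rw [chosenStrat, numStrats_input]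
    refine Finset.sum_congr rfl fun u hu => ?_
    rw [stratName_input _ _ (by simpa using hu), hβ, sameName_ofNat]
    split_ifs <;> simp_all
  by_cases hmem : β ∈ G.S i
  · obtain ⟨u, hu, rfl⟩ := G.exists_nameAt_eq hmem
    have h2 : chosenStrat (G.input k) a i = u := by
      rw [h1, Finset.sum_eq_single u, if_pos rfl]
      · intro v hv hne
        exact if_neg fun h => hne (G.nameAt_inj (by simpa using hv) hu h)
      · intro h
        exact absurd (by simpa using hu) h
    refine ⟨_, hmem, by rw [h2, stratName_input _ _ hu], fun α _ hα => ?_⟩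
    rw [hβ] at hα
    rw [← value_ofNat (G.nameAt i u), hα, value_ofNat]
  · have h2 : chosenStrat (G.input k) a i = 0 := by
      rw [h1]
      refine Finset.sum_eq_zero fun u hu => if_neg fun h => hmem ?_
      rw [← h]
      exact G.nameAt_mem (by simpa using hu)
    have h3 : 0 < (G.S i).card := (G.S_nonempty i).card_pos
    refine ⟨_, G.nameAt_mem h3, by rw [h2, stratName_input _ _ h3], fun α hα h => ?_⟩
    rw [hβ] at h
    rw [← value_ofNat β, h, value_ofNat] at hmem
    exact absurd hα hmem

/-! ### The guarantee -/

/-- An imposed joint strategy guarantees the payoffs that the players in `K` would have in the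
joint strategy that it is taken from: any other player can deviate to that joint strategy, and then
receives from the players in `K` what they would receive from this player. -/
theorem sum_payoff_le_welfare (σ : G.Profile) (K : Finset (Fin n)) (r : G.CoProfile K)
    (hr : G.IsNashGiven K (fun i => σ i.1) r) :
    ∑ j ∈ K, G.payoff σ j ≤ G.welfare (G.combine K (fun i => σ i.1) r) := by
  set f : G.PartialProfile K := fun i => σ i.1
  have h1 : ∑ j ∈ K, G.payoff σ j = ∑ i, ∑ j ∈ K, G.pairPay i j (σ i) (σ j) := by
    rw [Finset.sum_comm]
    refine Finset.sum_congr rfl fun j _ => ?_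
    rw [payoff_eq]
    refine Finset.sum_congr rfl fun i _ => G.pairPay_symm (σ j).2 (σ i).2 ?_
    rintro rfl
    rfl
  rw [h1, welfare]
  refine Finset.sum_le_sum fun i _ => ?_
  -- a player with strategy `σ i` receives at least the payoffs from the players in `K`
  have h2 : ∀ r : G.CoProfile K, G.combine K f r i = σ i →
      ∑ j ∈ K, G.pairPay i j (σ i) (σ j) ≤ G.payoff (G.combine K f r) i := by
    intro r hi
    rw [payoff_eq, hi]
    refine le_trans (le_of_eq (Finset.sum_congr rfl fun j hj => ?_))
      (Finset.sum_le_sum_of_subset_of_nonneg (Finset.subset_univ K) fun j _ _ =>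
        G.pairPay_nonneg (σ i).2 (G.combine K f r j).2)
    simp [combine, hj, f]
  by_cases hi : i ∈ K
  · exact h2 r (by simp [combine, hi, f])
  · refine (h2 (Function.update r ⟨i, hi⟩ (σ i)) (by simp [combine, hi])).trans ?_
    exact not_lt.1 (hr ⟨i, hi⟩ (σ i))

variable {G}

/-- The payoffs in the colouring are attained by the strategies with the names of the colours. -/
theorem IsMaxPay.colourPayoff_mul_le (hω : G.IsMaxPay ω) (hpos : 0 < ω) (a : Datum)
    (σ : G.Profile) (hσ : ∀ i : Fin n, ∀ α ∈ G.S i,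
      colourName (G.input k) (assigned a i - 1) = ofNat α → (σ i : ℕ) = α) (i : Fin n) :
    (colourPayoff (weight (G.input k)) n a i : ℚ) * ω ≤ scale (G.input k) * G.payoff σ i := by
  rw [colourPayoff, Finset.sum_range, payoff_eq, Nat.cast_sum, Finset.sum_mul, Finset.mul_sum]
  refine Finset.sum_le_sum fun j _ => ?_
  have h0 : (0 : ℚ) ≤ scale (G.input k) * G.pairPay i j (σ i) (σ j) :=
    mul_nonneg (by positivity) (G.pairPay_nonneg (σ i).2 (σ j).2)
  split_ifs with hij
  · obtain ⟨α, hα⟩ := G.exists_colourName_eq k (assigned a i - 1)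
    rw [hω.weight_input k hpos i j hα]
    split_ifs with hmem
    · rw [hσ i α hmem.1 hα, hσ j α hmem.2 (by rw [← hij, hα])] at h0 ⊢
      have := Nat.floor_le (div_nonneg h0 hpos.le)
      rwa [le_div_iff₀ hpos] at this
    · simpa using h0
  · simpa using h0

/-- The scaled optimum exceeds the welfare of the corresponding colouring by less than `1` for
every pair of players. -/
theorem IsMaxPay.exists_colouring (hω : G.IsMaxPay ω) (hpos : 0 < ω) (hdiag : G.DiagonalOnly)
    (opt : G.Profile) : ∃ s : ℕ → ℕ, (∀ i < n, s i < numColours (G.input k)) ∧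
      scale (G.input k) * G.welfare opt / ω ≤
        colourWelfare (weight (G.input k)) n s + n ^ 2 := by
  have h1 : ∀ a, ∃ c, ∀ i : Fin n, a ∈ G.S i →
      c < numColours (G.input k) ∧ colourName (G.input k) c = ofNat a := by
    intro a
    by_cases h : ∃ i, a ∈ G.S i
    · obtain ⟨i, hi⟩ := h
      obtain ⟨c, hc⟩ := G.exists_colour k hi
      exact ⟨c, fun _ _ => hc⟩
    · exact ⟨0, fun i hi => absurd ⟨i, hi⟩ h⟩
  choose col hcol using h1
  refine ⟨fun i => if h : i < n then col (opt ⟨i, h⟩) else 0, fun i hi => ?_, ?_⟩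
  · simp only [hi, dite_true]
    exact (hcol _ _ (opt ⟨i, hi⟩).2).1
  · have h2 : ((n : ℚ)) ^ 2 = ∑ _i : Fin n, ∑ _j : Fin n, (1 : ℚ) := by simp [sq]
    rw [colourWelfare, Finset.sum_range, welfare_eq, h2, Finset.mul_sum, Finset.sum_div,
      Nat.cast_sum, ← Finset.sum_add_distrib]
    refine Finset.sum_le_sum fun i _ => ?_
    rw [Finset.sum_range, Finset.mul_sum, Finset.sum_div, Nat.cast_sum, ← Finset.sum_add_distrib]
    refine Finset.sum_le_sum fun j _ => ?_
    simp only [Fin.is_lt, dite_true, Fin.eta]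
    by_cases hij : (opt i : ℕ) = opt j
    · have hj : (opt i : ℕ) ∈ G.S j := by rw [hij]; exact (opt j).2
      rw [← hij, if_pos rfl, hω.weight_input k hpos i j (hcol _ i (opt i).2).2,
        if_pos ⟨(opt i).2, hj⟩]
      exact (Nat.lt_floor_add_one _).le
    · have : G.pairPay i j (opt i) (opt j) = 0 := by
        have hne : i ≠ j := by rintro rfl; exact hij rfl
        simp only [pairPay, hne, if_false, zero_add]
        split_ifs with hadj
        · refine le_antisymm ?_ (G.edgePay_nonneg i j hadj _ (opt i).2 _ (opt j).2)
          exact not_lt.1 fun h => hij (hdiag i j hadj _ (opt i).2 _ (opt j).2 h)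
        · rfl
      rw [this, mul_zero, zero_div]
      positivity

theorem IsMaxPay.guarantees (hω : G.IsMaxPay ω) (hpos : 0 < ω) (hdiag : G.DiagonalOnly)
    (hk : k ≤ n) (σ : G.Profile) (hσ : ∀ i : Fin n, ∀ α ∈ G.S i,
      colourName (G.input k) (assigned (colouring (G.input k)) i - 1) = ofNat α → (σ i : ℕ) = α)
    (opt : G.Profile) (hopt : G.IsSocialOptimum opt) (r : G.CoProfile
      (Finset.univ.filter fun i : Fin n =>
        rankBelow n (colourPayoff (weight (G.input k)) n (colouring (G.input k))) i < k))
    (hr : G.IsNashGiven _ (fun i => σ i.1) r) :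
    (k : ℚ) / (2 * n) * G.welfare opt ≤ G.welfare (G.combine _ (fun i => σ i.1) r) := by
  refine le_trans ?_ (G.sum_payoff_le_welfare σ _ r hr)
  set a := colouring (G.input k) with ha
  set M := scale (G.input k) with hM
  set pay := colourPayoff (weight (G.input k)) n a with hpay
  set K := Finset.univ.filter fun i : Fin n => rankBelow n pay i < k with hK
  obtain ⟨i₀, j₀, a₀, ha₀, b₀, hb₀, hab⟩ := hω.2
  have hn : 0 < n := i₀.pos
  have hMdef : M = 16 * (n * n * (n * n)) := by rw [hM, scale, numPlayers_input]
  have hM0 : (0 : ℚ) < M := by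
    have : 0 < M := by rw [hMdef]; positivity
    exact_mod_cast this
  have hL : 0 < numColours (G.input k) := by
    obtain ⟨c, hc, -⟩ := G.exists_colour k ha₀
    omega
  obtain ⟨s, hs, hQ⟩ := hω.exists_colouring k hpos hdiag opt
  have hW : ∀ i < n, ∀ j < n, ∀ c, weight (G.input k) i j c = weight (G.input k) j i c := by
    intro i hi j hj c
    obtain ⟨α, hα⟩ := G.exists_colourName_eq k c
    have h1 := hω.weight_input k hpos ⟨i, hi⟩ ⟨j, hj⟩ hα
    have h2 := hω.weight_input k hpos ⟨j, hj⟩ ⟨i, hi⟩ hα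
    dsimp only at h1 h2
    rw [h1, h2]
    by_cases h : α ∈ G.S ⟨i, hi⟩ ∧ α ∈ G.S ⟨j, hj⟩
    · rw [if_pos h, if_pos h.symm, G.pairPay_symm h.1 h.2 fun _ => rfl]
    · rw [if_neg h, if_neg (mt And.symm h)]
  have hWM : ∀ i < n, ∀ j < n, ∀ c < numColours (G.input k), weight (G.input k) i j c ≤ M := by
    intro i hi j hj c _
    obtain ⟨α, hα⟩ := G.exists_colourName_eq k c
    have h1 := hω.weight_input k hpos ⟨i, hi⟩ ⟨j, hj⟩ hα
    dsimp only at h1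
    rw [h1]
    split_ifs with h
    · refine Nat.floor_le_of_le ?_
      rw [div_le_iff₀ hpos]
      exact mul_le_mul_of_nonneg_left (hω.1 _ _ _ h.1 _ h.2) hM0.le
    · exact Nat.zero_le _
  have hMQ : (M : ℚ) ≤ M * G.welfare opt / ω := by
    rw [le_div_iff₀ hpos, ← hab]
    exact mul_le_mul_of_nonneg_left (G.pairPay_le_optimum hopt ha₀ hb₀) hM0.le
  have h1 := le_two_mul_sum_colourPayoff hn hL hMdef rfl hW hWM s hs hMQ hQ
  have h2 : (∑ i ∈ Finset.range n, colourPayoff (weight (G.input k)) n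
      (assignment (weight (G.input k)) n (numColours (G.input k))
        (numColours (G.input k) * (M * M)) (counts (weight (G.input k)) n
          (numColours (G.input k)) (numColours (G.input k) * (M * M))) n) i) =
      ∑ i : Fin n, pay i := by
    rw [Finset.sum_range, hpay, ha, colouring, numPlayers_input, horizon]
  rw [h2] at h1
  have h3 : (k : ℚ) * (∑ i : Fin n, pay i : ℕ) ≤ n * (∑ i ∈ K, pay i : ℕ) := by
    exact_mod_cast mul_sum_le_mul_sum_rankBelow pay hk
  have h4 : ((∑ i ∈ K, pay i : ℕ) : ℚ) * ω ≤ M * ∑ i ∈ K, G.payoff σ i := by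
    rw [Nat.cast_sum, Finset.sum_mul, Finset.mul_sum]
    exact Finset.sum_le_sum fun i _ => hω.colourPayoff_mul_le k hpos a σ hσ i
  have hn' : (0 : ℚ) < n := by exact_mod_cast hn
  have hk0 : (0 : ℚ) ≤ k := by positivity
  rw [div_le_iff₀ hpos] at h1
  rw [div_mul_eq_mul_div, div_le_iff₀ (by positivity)]
  refine le_of_mul_le_mul_left ?_ hM0
  calc (M : ℚ) * (k * G.welfare opt) = k * (M * G.welfare opt) := by ring
    _ ≤ k * (2 * (∑ i : Fin n, pay i : ℕ) * ω) := mul_le_mul_of_nonneg_left h1 hk0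
    _ = 2 * ω * (k * (∑ i : Fin n, pay i : ℕ)) := by ring
    _ ≤ 2 * ω * (n * (∑ i ∈ K, pay i : ℕ)) := mul_le_mul_of_nonneg_left h3 (by positivity)
    _ = 2 * n * ((∑ i ∈ K, pay i : ℕ) * ω) := by ring
    _ ≤ 2 * n * (M * ∑ i ∈ K, G.payoff σ i) := mul_le_mul_of_nonneg_left h4 (by positivity)
    _ = M * ((∑ i ∈ K, G.payoff σ i) * (2 * n)) := by ring

theorem exists_isMaxPay (hn : 0 < n) : ∃ ω, G.IsMaxPay ω := by
  let P : Finset (Σ i : Fin n, Σ j : Fin n, {a // a ∈ G.S i} × {b // b ∈ G.S j}) := Finset.univ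
  obtain ⟨a, ha⟩ := G.S_nonempty ⟨0, hn⟩
  have hP : P.Nonempty := ⟨⟨_, _, ⟨a, ha⟩, ⟨a, ha⟩⟩, Finset.mem_univ _⟩
  obtain ⟨p, -, hp⟩ := P.exists_max_image (fun p => G.pairPay p.1 p.2.1 p.2.2.1 p.2.2.2) hP
  exact ⟨_, fun i j a ha b hb => hp ⟨i, j, ⟨a, ha⟩, ⟨b, hb⟩⟩ (Finset.mem_univ _),
    p.1, p.2.1, _, p.2.2.1.2, _, p.2.2.2.2, rfl⟩

theorem imposition_input (K : Finset (Fin n)) (σ : G.Profile)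
    (hK : ∀ i, i ∈ K ↔ 0 < selected (G.input k) (colouring (G.input k)) i)
    (hσ : ∀ i : Fin n, stratName (G.input k) i
      (chosenStrat (G.input k) (colouring (G.input k)) i) = ofNat (σ i)) :
    imposition (G.input k) = G.encodePartial K fun i => σ i.1 := by
  rw [imposition, encodePartial, table, numPlayers_input]
  congr 1
  refine List.ext_getElem (by simp) fun i hi _ => ?_
  have hi' : i < n := by simpa using hi
  have h1 := hK ⟨i, hi'⟩
  have h2 := hσ ⟨i, hi'⟩
  dsimp only at h1 h2
  rw [List.getElem_map, List.getElem_range, List.getElem_ofFn]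
  split_ifs with h3 h4 h4
  · rw [h2]
  · exact absurd (h1.2 h3) h4
  · exact absurd (h1.1 h4) h3
  · rfl

end CoordGame

/-- There is a polynomial-time program that, given a game whose edge games have positive entries on
the diagonal only, and a number `k ≤ n`, computes a joint strategy of `k` players that guarantees
a `k / (2n)` fraction of the optimal social welfare. -/
theorem mainTheorem10 :
    ∃ (c : Prog) (p : Polynomial ℕ),
      ∀ (n : ℕ) (G : CoordGame n), G.DiagonalOnly → ∀ k : ℕ, k ≤ n →
        ∃ (K : Finset (Fin n)) (f : G.PartialProfile K),
          K.card = k ∧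
          (∀ opt : G.Profile, G.IsSocialOptimum opt →
            G.Guarantees K f ((k : ℚ) / (2 * (n : ℚ)) * G.welfare opt)) ∧
          ∃ t : ℕ, t ≤ p.eval (Datum.node G.encode (Datum.ofNat k)).size ∧
            Runs c (Datum.node G.encode (Datum.ofNat k)) (G.encodePartial K f) t := by
  obtain ⟨c, p, hc⟩ := PolyTime.imposition (PolyTime.refl fun D : Datum => D)
  refine ⟨c, p, fun n G hdiag k hk => ?_⟩
  choose σ hmem hσ hcol using G.exists_strategy k (colouring (G.input k))
  let σ' : G.Profile := fun i => ⟨σ i, hmem i⟩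
  refine ⟨Finset.univ.filter fun i : Fin n =>
    rankBelow n (colourPayoff (weight (G.input k)) n (colouring (G.input k))) i < k,
    fun i => σ' i.1, card_rankBelow_lt _ hk, fun opt hopt r hr => ?_, ?_⟩
  · by_cases hω : ∃ ω, G.IsMaxPay ω ∧ 0 < ω
    · obtain ⟨ω, hω, hpos⟩ := hω
      exact hω.guarantees k hpos hdiag hk σ' hcol opt hopt r hr
    · -- all payoffs vanish
      have h0 : G.welfare opt = 0 := by
        refine le_antisymm ?_ (G.welfare_nonneg opt)
        rw [CoordGame.welfare_eq]
        refine Finset.sum_nonpos fun i _ => Finset.sum_nonpos fun j _ => ?_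
        obtain ⟨ω, h⟩ := CoordGame.exists_isMaxPay (G := G) i.pos
        exact (h.1 i j _ (opt i).2 _ (opt j).2).trans (not_lt.1 fun hpos => hω ⟨ω, h, hpos⟩)
      rw [h0, mul_zero]
      exact G.welfare_nonneg _
  · rw [← CoordGame.imposition_input k _ σ' (fun i => ?_) hσ]
    · exact hc (G.input k)
    · rw [CoordGame.selected_input]; simp
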